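/- Let $B_1=\{(x,y)\in\mathbb R^2: x^2+y^2<1\}$ and $B_1^{\pm}=B_1\cap\{\pm y>0\}$. Let $a\in C^3(\overline{B_1^+},\mathbb R^2)$, let $c_\alpha\in C^2(\overline{B_1^+})$ for $|\alpha|\le 2$, and put $q_2(v)=\sum_{|\alpha|\le 2}c_\alpha D^\alpha v$. Let $u\in H^6(B_1^+)$ be a real-valued solution of $$\Delta^2u=F\ \text{ in } B_1^+,\qquad F:=a\cdot\nabla\Delta u+q_2(u),\qquad u(x,0)=u_y(x,0)=0\ \text{ for all } x\in(-1,1),$$ where derivatives are weak derivatives, equations hold almost everywhere, and the boundary values are those of the representatives of $u$ and $u_y$ that are continuous up to $\{y=0\}\cap B_1$. Define $\overline u$ on $B_1$ by $\overline u=u$ in $B_1^+$ and $\overline u=w$ in $B_1^-$, where $$w(x,y)=-\left[u(x,-y)+2y\,u_y(x,-y)+y^2\,\Delta u(x,-y)\right].$$ Then $F\in H^2(B_1^+)$, $\overline u\in H^4(B_1)$, and $$\Delta^2\overline u=\overline F\quad\text{a.e. in } B_1,$$ where $\overline F=F$ in $B_1^+$ and $\overline F=F_1$ in $B_1^-$,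 with $$F_1(x,y)=-\left[5F(x,-y)-6y\,F_y(x,-y)+y^2\,\Delta F(x,-y)\right].$$ -/

import Mathlib

open MeasureTheory Set Filter Topology
open scoped ContDiff

noncomputable section

namespace PlateReflection

/-- The open unit disc of the plane; points are `p = (x, y)`, so `p.1 = x` and `p.2 = y`. -/
def disc : Set (ℝ × ℝ) := {p | p.1 ^ 2 + p.2 ^ 2 < 1}

/-- The open upper half disc. -/
def halfDisc : Set (ℝ × ℝ) := {p | p.1 ^ 2 + p.2 ^ 2 < 1 ∧ 0 < p.2}

/-- Classical partial derivative in the first variable (applied to test functions only). -/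
def dx (φ : ℝ × ℝ → ℝ) : ℝ × ℝ → ℝ := fun p => fderiv ℝ φ p (1, 0)

/-- Classical partial derivative in the second variable (applied to test functions only). -/
def dy (φ : ℝ × ℝ → ℝ) : ℝ × ℝ → ℝ := fun p => fderiv ℝ φ p (0, 1)

/-- Test functions: smooth functions with compact support contained in `Ω`. -/
def IsTestFunction (Ω : Set (ℝ × ℝ)) (φ : ℝ × ℝ → ℝ) : Prop :=
  ContDiff ℝ ∞ φ ∧ HasCompactSupport φ ∧ tsupport φ ⊆ Ω

/-- `g` is a weak derivative of `f` on `Ω`, of order `i` in `x` and order `j` in `y`. -/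
def IsWeakDeriv (Ω : Set (ℝ × ℝ)) (i j : ℕ) (f g : ℝ × ℝ → ℝ) : Prop :=
  LocallyIntegrableOn f Ω ∧ LocallyIntegrableOn g Ω ∧
    ∀ φ : ℝ × ℝ → ℝ, IsTestFunction Ω φ →
      ∫ p in Ω, f p * (dx^[i] (dy^[j] φ)) p = (-1) ^ (i + j) * ∫ p in Ω, g p * φ p

/-- The Sobolev space `H ^ k (Ω)`: square integrable functions all of whose weak derivatives
of order at most `k` exist and are square integrable. -/
def MemH (k : ℕ) (Ω : Set (ℝ × ℝ)) (f : ℝ × ℝ → ℝ) : Prop :=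
  MemLp f 2 (volume.restrict Ω) ∧
    ∀ i j : ℕ, i + j ≤ k →
      ∃ g : ℝ × ℝ → ℝ, MemLp g 2 (volume.restrict Ω) ∧ IsWeakDeriv Ω i j f g

open Classical in
/-- The weak derivative of `f` on `Ω` of order `i` in `x` and `j` in `y`. Weak derivatives are
unique up to null sets of `Ω`; the operator picks one (and is `0` if there is none). -/
def weakD (Ω : Set (ℝ × ℝ)) (i j : ℕ) (f : ℝ × ℝ → ℝ) : ℝ × ℝ → ℝ :=
  if h : ∃ g, IsWeakDeriv Ω i j f g then h.choose else 0

/-- The Laplacian in the sense of weak derivatives. -/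
def weakLap (Ω : Set (ℝ × ℝ)) (f : ℝ × ℝ → ℝ) : ℝ × ℝ → ℝ :=
  fun p => weakD Ω 2 0 f p + weakD Ω 0 2 f p

/-- The function `f`, given up to null sets of `Ω`, has the value `c` at the boundary point `q`
of `Ω`: it tends to `c` at `q` along `Ω`, up to a null set. If `f` agrees a.e. in `Ω` with a
function that is continuous on `Ω ∪ {q}`, then this says that the latter takes the value `c`
at `q`. -/
def HasBoundaryValue (Ω : Set (ℝ × ℝ)) (f : ℝ × ℝ → ℝ) (q : ℝ × ℝ) (c : ℝ) : Prop :=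
  Tendsto f (𝓝 q ⊓ ae (volume.restrict Ω)) (𝓝 c)

/-- The right-hand side `F = a · ∇Δu + ∑_{i + j ≤ 2} c i j ∂ₓ^i ∂_y^j u`
on the upper half disc. -/
def rhsF (a : ℝ × ℝ → ℝ × ℝ) (c : ℕ → ℕ → ℝ × ℝ → ℝ) (u : ℝ × ℝ → ℝ) : ℝ × ℝ → ℝ :=
  fun p =>
    (a p).1 * weakD halfDisc 1 0 (weakLap halfDisc u) p +
      (a p).2 * weakD halfDisc 0 1 (weakLap halfDisc u) p +
      ∑ i ∈ Finset.range 3, ∑ j ∈ Finset.range (3 - i), c i j p * weakD halfDisc i j u p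

/-- The function `w` on the lower half disc, built from `u` on the upper half disc. -/
def reflected (u : ℝ × ℝ → ℝ) : ℝ × ℝ → ℝ :=
  fun p => -(u (p.1, -p.2) + 2 * p.2 * weakD halfDisc 0 1 u (p.1, -p.2) +
    p.2 ^ 2 * weakLap halfDisc u (p.1, -p.2))

/-- The extension of `u` to the disc: `u` above the axis and `w` below it
(the axis is a null set). -/
def extended (u : ℝ × ℝ → ℝ) : ℝ × ℝ → ℝ :=
  fun p => if 0 < p.2 then u p else reflected u p

/-- The function `F₁` on the lower half disc, built from `F` on the upper half disc. -/
def reflectedRhs (F : ℝ × ℝ → ℝ) : ℝ × ℝ → ℝ :=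
  fun p => -(5 * F (p.1, -p.2) - 6 * p.2 * weakD halfDisc 0 1 F (p.1, -p.2) +
    p.2 ^ 2 * weakLap halfDisc F (p.1, -p.2))

/-- The extension of `F` to the disc: `F` above the axis and `F₁` below it. -/
def extendedRhs (F : ℝ × ℝ → ℝ) : ℝ × ℝ → ℝ :=
  fun p => if 0 < p.2 then F p else reflectedRhs F p

end PlateReflection

end

open PlateReflection

/-!
The boundary conditions and the equation are only given on the upper half disc, while the extension
`extended u` has to be differentiated across the axis. Pulled back to the upper half disc by the
reflection in the axis, the lower part of the extension is `-(u - 2 y u_y + y² Δu)`. Computing its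
derivatives in `y` up to order three shows that its jump against `u`, with the signs that the
reflection produces, is at each order a derivative along the axis of `u` or of `u_y`, up to a
multiple of `y` (`IsDerivFamily.zeroTrace_jump`). All of these vanish on the axis, so no singular
part arises there and `extended u` is in `H ^ 4`. Its bilaplacian can then be computed on each side
separately, which on the lower side is an algebraic identity (`lowerFamily_bilaplacian`) together
with `Δ²u = F`.

Neither traces nor Sobolev embeddings are needed. That `f` vanishes on the axis is expressed by the
extension of `f` by zero having a weak derivative in `y` on the whole disc (`ZeroTrace`). This
follows from boundary values `0` by cutting off the test function in a thin layer along the axis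
(`IsWeakDeriv.integral_mul_dy_of_hasBoundaryValue`), it holds for every multiple of `y`
(`HasIntegrableDy.zeroTrace_snd_mul`), and it passes to derivatives along the axis because weak
derivatives commute (`ZeroTrace.dx`). Two functions can be glued along the axis without a singular
part if their difference has trace zero (`IsWeakDeriv.glue_dy`), since the even extension of a
weakly differentiable function is weakly differentiable.

That `F` is in `H ^ 2` is the product rule for weak derivatives (`MemH.contDiffOn_mul`), whose proof
requires test functions that are merely `C¹` (`integral_mul_fderiv_of_contDiff_one`).
-/

noncomputable section

namespace PlateReflection

/-! ### Test functions -/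

section TestFunctions

variable {Ω : Set (ℝ × ℝ)} {φ : ℝ × ℝ → ℝ}

theorem contDiff_dx (h : ContDiff ℝ ∞ φ) : ContDiff ℝ ∞ (dx φ) :=
  (h.fderiv_right (m := ∞) (by norm_num)).clm_apply contDiff_const

theorem contDiff_dy (h : ContDiff ℝ ∞ φ) : ContDiff ℝ ∞ (dy φ) :=
  (h.fderiv_right (m := ∞) (by norm_num)).clm_apply contDiff_const

theorem tsupport_fderiv_apply_subset (φ : ℝ × ℝ → ℝ) (v : ℝ × ℝ) :
    tsupport (fun p => fderiv ℝ φ p v) ⊆ tsupport φ := by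
  refine (closure_mono ?_).trans (tsupport_fderiv_subset ℝ (f := φ))
  intro p hp h0
  exact hp (by simp [h0])

theorem IsTestFunction.dx (h : IsTestFunction Ω φ) : IsTestFunction Ω (dx φ) :=
  ⟨contDiff_dx h.1, h.2.1.mono' (subset_closure.trans (tsupport_fderiv_apply_subset φ _)),
    (tsupport_fderiv_apply_subset φ _).trans h.2.2⟩

theorem IsTestFunction.dy (h : IsTestFunction Ω φ) : IsTestFunction Ω (dy φ) :=
  ⟨contDiff_dy h.1, h.2.1.mono' (subset_closure.trans (tsupport_fderiv_apply_subset φ _)),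
    (tsupport_fderiv_apply_subset φ _).trans h.2.2⟩

theorem IsTestFunction.iterate_dy (h : IsTestFunction Ω φ) (j : ℕ) :
    IsTestFunction Ω (PlateReflection.dy^[j] φ) := by
  induction j with
  | zero => exact h
  | succ j ih => rw [Function.iterate_succ_apply']; exact ih.dy

theorem IsTestFunction.iterate_dx (h : IsTestFunction Ω φ) (i : ℕ) :
    IsTestFunction Ω (PlateReflection.dx^[i] φ) := by
  induction i with
  | zero => exact h
  | succ i ih => rw [Function.iterate_succ_apply']; exact ih.dx

theorem dy_dx (h : ContDiff ℝ ∞ φ) : dy (dx φ) = dx (dy φ) := by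
  funext p
  have hd : DifferentiableAt ℝ (fderiv ℝ φ) p :=
    ((h.fderiv_right (m := 1) (by norm_cast)).differentiable (by norm_num)).differentiableAt
  have key : ∀ v w : ℝ × ℝ, fderiv ℝ (fun q => fderiv ℝ φ q v) p w
      = fderiv ℝ (fderiv ℝ φ) p w v := by
    intro v w
    rw [fderiv_clm_apply hd (differentiableAt_const v)]
    simp
  have hs : IsSymmSndFDerivAt ℝ φ p :=
    h.contDiffAt.isSymmSndFDerivAt (by
      rw [minSmoothness_of_isRCLikeNormedField]
      exact WithTop.coe_le_coe.2 (le_top : (2 : ℕ∞) ≤ ⊤))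
  change fderiv ℝ (fun q => fderiv ℝ φ q (1, 0)) p (0, 1)
    = fderiv ℝ (fun q => fderiv ℝ φ q (0, 1)) p (1, 0)
  rw [key, key]
  exact hs _ _

theorem IsTestFunction.iterate_dy_dx (h : IsTestFunction Ω φ) (j : ℕ) :
    PlateReflection.dy^[j] (PlateReflection.dx φ) = PlateReflection.dx (PlateReflection.dy^[j] φ) := by
  induction j with
  | zero => rfl
  | succ j ih =>
    rw [Function.iterate_succ_apply', Function.iterate_succ_apply', ih,
      dy_dx (h.iterate_dy j).1]

theorem IsTestFunction.iterate_dy_iterate_dx (h : IsTestFunction Ω φ) (i j : ℕ) :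
    PlateReflection.dy^[j] (PlateReflection.dx^[i] φ)
      = PlateReflection.dx^[i] (PlateReflection.dy^[j] φ) := by
  induction i with
  | zero => rfl
  | succ i ih =>
    rw [Function.iterate_succ_apply', Function.iterate_succ_apply',
      (h.iterate_dx i).iterate_dy_dx, ih]

theorem IsTestFunction.iterate_add (h : IsTestFunction Ω φ) (i j k l : ℕ) :
    PlateReflection.dx^[i] (PlateReflection.dy^[j]
      (PlateReflection.dx^[k] (PlateReflection.dy^[l] φ)))
      = PlateReflection.dx^[i + k] (PlateReflection.dy^[j + l] φ) := by
  rw [(h.iterate_dy l).iterate_dy_iterate_dx, Function.iterate_add_apply,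
    Function.iterate_add_apply]

theorem integrableOn_mul_of_tsupport_subset {f χ : ℝ × ℝ → ℝ} (hf : LocallyIntegrableOn f Ω)
    (hχ : Continuous χ) (hc : HasCompactSupport χ) (hs : tsupport χ ⊆ Ω) :
    IntegrableOn (fun p => f p * χ p) Ω := by
  have h1 : IntegrableOn (fun p => f p * χ p) (tsupport χ) :=
    (hf.integrableOn_compact_subset hs hc).mul_continuousOn hχ.continuousOn hc
  have h2 : Integrable (fun p => f p * χ p) :=
    (integrableOn_iff_integrable_of_support_subset
      (fun p hp => subset_tsupport χ (fun h0 => hp (by simp [h0])))).1 h1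
  exact h2.integrableOn

theorem IsTestFunction.integrableOn_mul {f : ℝ × ℝ → ℝ} (h : IsTestFunction Ω φ)
    (hf : LocallyIntegrableOn f Ω) : IntegrableOn (fun p => f p * φ p) Ω :=
  integrableOn_mul_of_tsupport_subset hf h.1.continuous h.2.1 h.2.2

end TestFunctions

/-! ### The calculus of weak derivatives -/

section WeakDerivatives

variable {Ω : Set (ℝ × ℝ)} {i j k l : ℕ} {f g h f' g' : ℝ × ℝ → ℝ}

theorem IsWeakDeriv.trans (h₁ : IsWeakDeriv Ω i j f g) (h₂ : IsWeakDeriv Ω k l g h) :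
    IsWeakDeriv Ω (i + k) (j + l) f h := by
  refine ⟨h₁.1, h₂.2.1, fun φ hφ => ?_⟩
  have e₁ := h₁.2.2 _ ((hφ.iterate_dy l).iterate_dx k)
  have e₂ := h₂.2.2 φ hφ
  rw [hφ.iterate_add] at e₁
  rw [e₁, e₂, ← mul_assoc, ← pow_add]
  congr 2; ring

/-- A weak derivative of `f` of order `α + β` is a weak derivative of order `β` of the weak
derivative of `f` of order `α`. -/
theorem IsWeakDeriv.of_trans (h₁ : IsWeakDeriv Ω i j f g)
    (h₂ : IsWeakDeriv Ω (i + k) (j + l) f h) : IsWeakDeriv Ω k l g h := by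
  refine ⟨h₁.2.1, h₂.2.1, fun φ hφ => ?_⟩
  have e₁ := h₁.2.2 _ ((hφ.iterate_dy l).iterate_dx k)
  have e₂ := h₂.2.2 φ hφ
  rw [hφ.iterate_add] at e₁
  rw [e₁] at e₂
  have e : ((-1 : ℝ) ^ (i + j)) * (-1) ^ (i + j) = 1 := by
    rw [← mul_pow]; norm_num
  calc _ = (-1 : ℝ) ^ (i + j) * ((-1 : ℝ) ^ (i + j)
        * ∫ p in Ω, g p * (dx^[k] (dy^[l] φ)) p) := by rw [← mul_assoc, e, one_mul]
    _ = _ := by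
      rw [e₂, ← mul_assoc, ← pow_add]
      congr 1
      rw [show i + j + (i + k + (j + l)) = (i + j) + (i + j) + (k + l) by ring, pow_add,
        pow_add, e, one_mul]

theorem IsWeakDeriv.congr (h₁ : IsWeakDeriv Ω i j f g) (hf : f =ᵐ[volume.restrict Ω] f')
    (hg : g =ᵐ[volume.restrict Ω] g') : IsWeakDeriv Ω i j f' g' := by
  refine ⟨h₁.1.congr hf, h₁.2.1.congr hg, fun φ hφ => ?_⟩
  have e₁ : (fun p => f p * (dx^[i] (dy^[j] φ)) p) =ᵐ[volume.restrict Ω]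
      fun p => f' p * (dx^[i] (dy^[j] φ)) p := hf.mono fun p hp => by simp only [hp]
  have e₂ : (fun p => g p * φ p) =ᵐ[volume.restrict Ω] fun p => g' p * φ p :=
    hg.mono fun p hp => by simp only [hp]
  rw [← integral_congr_ae e₁, h₁.2.2 φ hφ, integral_congr_ae e₂]

theorem IsWeakDeriv.unique (hΩ : IsOpen Ω) (h₁ : IsWeakDeriv Ω i j f g)
    (h₂ : IsWeakDeriv Ω i j f g') : g =ᵐ[volume.restrict Ω] g' := by
  have key : ∀ᵐ p, p ∈ Ω → (g - g') p = 0 := by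
    refine hΩ.ae_eq_zero_of_integral_contDiff_smul_eq_zero (h₁.2.1.sub h₂.2.1) ?_
    intro φ hφ hc hs
    have hT : IsTestFunction Ω φ := ⟨hφ, hc, hs⟩
    have e : ∫ p in Ω, g p * φ p = ∫ p in Ω, g' p * φ p := by
      have e₁ := h₁.2.2 φ hT
      rw [h₂.2.2 φ hT] at e₁
      exact (mul_left_cancel₀ (pow_ne_zero _ (by norm_num)) e₁).symm
    have hsupp : Function.support (fun p => φ p • (g - g') p) ⊆ Ω := fun p hp =>
      hs (subset_tsupport φ (fun h0 => hp (by simp [h0])))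
    rw [← setIntegral_eq_integral_of_forall_compl_eq_zero
      (s := Ω) (fun p hp => by_contra fun h0 => hp (hsupp h0))]
    have : ∀ p, φ p • (g - g') p = g p * φ p - g' p * φ p := fun p => by
      simp only [Pi.sub_apply, smul_eq_mul]; ring
    simp_rw [this]
    rw [integral_sub (hT.integrableOn_mul h₁.2.1) (hT.integrableOn_mul h₂.2.1), e, sub_self]
  rw [← ae_restrict_iff' hΩ.measurableSet] at key
  exact key.mono fun p hp => sub_eq_zero.1 hp

theorem IsWeakDeriv.weakD (h : IsWeakDeriv Ω i j f g) :
    IsWeakDeriv Ω i j f (weakD Ω i j f) := by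
  have hex : ∃ g, IsWeakDeriv Ω i j f g := ⟨g, h⟩
  rw [PlateReflection.weakD, dif_pos hex]
  exact hex.choose_spec

theorem IsWeakDeriv.weakD_ae_eq (hΩ : IsOpen Ω) (h : IsWeakDeriv Ω i j f g) :
    PlateReflection.weakD Ω i j f =ᵐ[volume.restrict Ω] g :=
  h.weakD.unique hΩ h

theorem IsWeakDeriv.add (h₁ : IsWeakDeriv Ω i j f g) (h₂ : IsWeakDeriv Ω i j f' g') :
    IsWeakDeriv Ω i j (fun p => f p + f' p) (fun p => g p + g' p) := by
  refine ⟨h₁.1.add h₂.1, h₁.2.1.add h₂.2.1, fun φ hφ => ?_⟩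
  have hd := (hφ.iterate_dy j).iterate_dx i
  simp_rw [add_mul]
  rw [integral_add (hd.integrableOn_mul h₁.1) (hd.integrableOn_mul h₂.1),
    integral_add (hφ.integrableOn_mul h₁.2.1) (hφ.integrableOn_mul h₂.2.1),
    h₁.2.2 φ hφ, h₂.2.2 φ hφ, mul_add]

theorem IsWeakDeriv.const_mul (h₁ : IsWeakDeriv Ω i j f g) (c : ℝ) :
    IsWeakDeriv Ω i j (fun p => c * f p) (fun p => c * g p) := by
  refine ⟨h₁.1.smul c, h₁.2.1.smul c, fun φ hφ => ?_⟩
  simp_rw [mul_assoc]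
  rw [integral_const_mul, integral_const_mul, h₁.2.2 φ hφ]
  ring

theorem isWeakDeriv_self (hf : LocallyIntegrableOn f Ω) : IsWeakDeriv Ω 0 0 f f :=
  ⟨hf, hf, fun φ _ => by simp⟩

end WeakDerivatives

/-! ### Test functions of class `C¹` and the product rule -/

section ProductRule

variable {Ω : Set (ℝ × ℝ)} {f g : ℝ × ℝ → ℝ}

theorem abs_setIntegral_mul_le {K : Set (ℝ × ℝ)} {r : ℝ × ℝ → ℝ} {ε : ℝ}
    (hf : LocallyIntegrableOn f Ω) (hΩ : IsOpen Ω) (hK : IsCompact K) (hKΩ : K ⊆ Ω)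
    (hr : ∀ p, |r p| ≤ ε) (hr0 : ∀ p, p ∉ K → r p = 0) :
    |∫ p in Ω, f p * r p| ≤ ε * ∫ p in K, |f p| := by
  rw [setIntegral_eq_of_subset_of_forall_sdiff_eq_zero hΩ.measurableSet hKΩ
    (fun p hp => by rw [hr0 p hp.2, mul_zero]), ← integral_const_mul]
  rw [← Real.norm_eq_abs]
  refine norm_integral_le_of_norm_le
    ((hf.integrableOn_compact_subset hKΩ hK).abs.const_mul ε) (ae_of_all _ fun p => ?_)
  rw [Real.norm_eq_abs, abs_mul, mul_comm]
  exact mul_le_mul_of_nonneg_right (hr p) (abs_nonneg _)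

/-- A `C¹` function of compact support is a uniform limit, together with a directional
derivative, of test functions supported close to its support. -/
theorem exists_testFunction_approx {χ : ℝ × ℝ → ℝ} (hχ : ContDiff ℝ 1 χ)
    (hc : HasCompactSupport χ) (v : ℝ × ℝ) {δ ε : ℝ} (hδ : 0 < δ) (hε : 0 < ε) :
    ∃ ψ : ℝ × ℝ → ℝ, ContDiff ℝ ∞ ψ ∧ tsupport ψ ⊆ Metric.cthickening δ (tsupport χ) ∧
      (∀ p, |ψ p - χ p| ≤ ε) ∧ ∀ p, |fderiv ℝ ψ p v - fderiv ℝ χ p v| ≤ ε := by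
  have hdc : Continuous (fun p => fderiv ℝ χ p v) :=
    (hχ.continuous_fderiv one_ne_zero).clm_apply continuous_const
  have hdcs : HasCompactSupport (fun p => fderiv ℝ χ p v) :=
    hc.mono' (subset_closure.trans (tsupport_fderiv_apply_subset χ v))
  obtain ⟨δ₁, hδ₁, h₁⟩ := Metric.uniformContinuous_iff.1
    (hc.uniformContinuous_of_continuous hχ.continuous) ε hε
  obtain ⟨δ₂, hδ₂, h₂⟩ := Metric.uniformContinuous_iff.1
    (hdcs.uniformContinuous_of_continuous hdc) ε hε
  set r := min δ (min δ₁ δ₂) with hr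
  have hr0 : 0 < r := by positivity
  let b : ContDiffBump (0 : ℝ × ℝ) := ⟨r / 2, r, by positivity, by linarith⟩
  have hb : b.rOut = r := rfl
  have hbl : LocallyIntegrable (b.normed volume) volume :=
    (b.continuous_normed).locallyIntegrable
  refine ⟨convolution (b.normed volume) χ (ContinuousLinearMap.lsmul ℝ ℝ) volume,
    ?_, ?_, fun p => ?_, fun p => ?_⟩
  · exact b.hasCompactSupport_normed.contDiff_convolution_left _ b.contDiff_normed
      hχ.continuous.locallyIntegrable
  · refine closure_minimal ?_ Metric.isClosed_cthickening
    refine (support_convolution_subset _).trans ?_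
    rintro p ⟨x, hx, y, hy, rfl⟩
    rw [b.support_normed_eq, hb, mem_ball_zero_iff] at hx
    refine Metric.mem_cthickening_of_dist_le _ y _ _ (subset_tsupport χ hy) ?_
    simp only [dist_add_self_left]
    exact hx.le.trans (min_le_left _ _)
  · rw [← Real.dist_eq]
    refine b.dist_normed_convolution_le hχ.continuous.aestronglyMeasurable fun x hx => ?_
    rw [hb, Metric.mem_ball] at hx
    exact (h₁ (hx.trans_le ((min_le_right _ _).trans (min_le_left _ _)))).le
  · rw [← Real.dist_eq, (hc.hasFDerivAt_convolution_right _ hbl hχ p).fderiv,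
      convolution_precompR_apply _ hbl (hc.fderiv ℝ) (hχ.continuous_fderiv one_ne_zero)]
    refine b.dist_normed_convolution_le (g := fun p => fderiv ℝ χ p v)
      hdc.aestronglyMeasurable fun x hx => ?_
    rw [hb, Metric.mem_ball] at hx
    exact (h₂ (hx.trans_le ((min_le_right _ _).trans (min_le_right _ _)))).le

/-- The integration by parts formula extends from test functions to compactly supported
functions of class `C¹`. -/
theorem integral_mul_fderiv_of_contDiff_one (hΩ : IsOpen Ω) {v : ℝ × ℝ}
    (hf : LocallyIntegrableOn f Ω) (hg : LocallyIntegrableOn g Ω)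
    (h : ∀ φ, IsTestFunction Ω φ →
      ∫ p in Ω, f p * fderiv ℝ φ p v = -∫ p in Ω, g p * φ p)
    {χ : ℝ × ℝ → ℝ} (hχ : ContDiff ℝ 1 χ) (hc : HasCompactSupport χ) (hs : tsupport χ ⊆ Ω) :
    ∫ p in Ω, f p * fderiv ℝ χ p v = -∫ p in Ω, g p * χ p := by
  have hc' : IsCompact (tsupport χ) := hc
  obtain ⟨δ, hδ, hδΩ⟩ := hc'.exists_cthickening_subset_open hΩ hs
  set K := Metric.cthickening δ (tsupport χ) with hK
  have hKc : IsCompact K := hc'.cthickening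
  have hχK : tsupport χ ⊆ K := Metric.self_subset_cthickening _
  set M := (∫ p in K, |f p|) + ∫ p in K, |g p| with hM
  have hM0 : 0 ≤ M := by positivity
  have hdc : Continuous (fun p => fderiv ℝ χ p v) :=
    (hχ.continuous_fderiv one_ne_zero).clm_apply continuous_const
  have hdcs : HasCompactSupport (fun p => fderiv ℝ χ p v) :=
    hc.mono' (subset_closure.trans (tsupport_fderiv_apply_subset χ v))
  have key : ∀ ε > 0,
      |(∫ p in Ω, f p * fderiv ℝ χ p v) + ∫ p in Ω, g p * χ p| ≤ ε * M := by
    intro ε hε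
    obtain ⟨ψ, hψ, hψK, h₀, h₁⟩ := exists_testFunction_approx hχ hc v hδ hε
    have hψT : IsTestFunction Ω ψ :=
      ⟨hψ, HasCompactSupport.intro hKc fun p hp => image_eq_zero_of_notMem_tsupport
        fun hp' => hp (hψK hp'), hψK.trans hδΩ⟩
    have hdψ : Continuous (fun p => fderiv ℝ ψ p v) :=
      (hψ.continuous_fderiv (by simp)).clm_apply continuous_const
    have z : ∀ (η : ℝ × ℝ → ℝ), tsupport η ⊆ K → ∀ p, p ∉ K → η p = 0 := fun η hη p hp =>
      image_eq_zero_of_notMem_tsupport fun hp' => hp (hη hp')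
    have e₁ := abs_setIntegral_mul_le (r := fun p => fderiv ℝ ψ p v - fderiv ℝ χ p v)
      hf hΩ hKc hδΩ h₁ (fun p hp => by
        rw [z _ ((tsupport_fderiv_apply_subset ψ v).trans hψK) p hp,
          z _ ((tsupport_fderiv_apply_subset χ v).trans hχK) p hp, sub_zero])
    have e₂ := abs_setIntegral_mul_le (r := fun p => ψ p - χ p)
      hg hΩ hKc hδΩ h₀ (fun p hp => by rw [z _ hψK p hp, z _ hχK p hp, sub_zero])
    have i₁ := integrableOn_mul_of_tsupport_subset hf hdc hdcs
      ((tsupport_fderiv_apply_subset χ v).trans hs)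
    have i₂ := integrableOn_mul_of_tsupport_subset hf hdψ
      (hψT.2.1.mono' (subset_closure.trans (tsupport_fderiv_apply_subset ψ v)))
      ((tsupport_fderiv_apply_subset ψ v).trans hψT.2.2)
    have i₃ := integrableOn_mul_of_tsupport_subset hg hχ.continuous hc hs
    have i₄ := hψT.integrableOn_mul hg
    simp_rw [mul_sub] at e₁ e₂
    rw [integral_sub i₂ i₁, h ψ hψT] at e₁
    rw [integral_sub i₄ i₃] at e₂
    calc _ = |-((-(∫ p in Ω, g p * ψ p) - ∫ p in Ω, f p * fderiv ℝ χ p v)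
          + ((∫ p in Ω, g p * ψ p) - ∫ p in Ω, g p * χ p))| := by congr 1; ring
      _ ≤ _ := by
        rw [abs_neg]
        refine (abs_add_le _ _).trans ?_
        rw [hM, mul_add]
        exact add_le_add e₁ e₂
  have h0 : |(∫ p in Ω, f p * fderiv ℝ χ p v) + ∫ p in Ω, g p * χ p| ≤ 0 := by
    refine le_of_forall_pos_le_add fun ε hε => ?_
    refine (key (ε / (M + 1)) (by positivity)).trans ?_
    rw [zero_add, div_mul_eq_mul_div, div_le_iff₀ (by positivity)]
    nlinarith
  exact eq_neg_of_add_eq_zero_left (abs_nonpos_iff.1 h0)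

/-- The product rule, in the direction `v`: the product of a `C¹` function with a test function
serves as a `C¹` test function. -/
theorem integral_product_rule (hΩ : IsOpen Ω) {v : ℝ × ℝ} {c : ℝ × ℝ → ℝ}
    (hcd : ContDiffOn ℝ 1 c Ω) (hf : LocallyIntegrableOn f Ω) (hg : LocallyIntegrableOn g Ω)
    (h : ∀ φ, IsTestFunction Ω φ →
      ∫ p in Ω, f p * fderiv ℝ φ p v = -∫ p in Ω, g p * φ p) :
    LocallyIntegrableOn (fun p => c p * f p) Ω ∧
      LocallyIntegrableOn (fun p => fderiv ℝ c p v * f p + c p * g p) Ω ∧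
      ∀ φ, IsTestFunction Ω φ → ∫ p in Ω, (c p * f p) * fderiv ℝ φ p v
        = -∫ p in Ω, (fderiv ℝ c p v * f p + c p * g p) * φ p := by
  have hdc : ContinuousOn (fun p => fderiv ℝ c p v) Ω :=
    (hcd.continuousOn_fderiv_of_isOpen hΩ le_rfl).clm_apply continuousOn_const
  have l₀ := hf.continuousOn_mul hcd.continuousOn hΩ.isLocallyClosed
  have l₁ := hf.continuousOn_mul hdc hΩ.isLocallyClosed
  have l₂ := hg.continuousOn_mul hcd.continuousOn hΩ.isLocallyClosed
  refine ⟨l₀, l₁.add l₂, fun φ hφ => ?_⟩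
  have hts : tsupport (fun p => c p * φ p) ⊆ tsupport φ := tsupport_mul_subset_right
  have hχ : ContDiff ℝ 1 (fun p => c p * φ p) := by
    refine contDiff_iff_contDiffAt.2 fun p => ?_
    by_cases hp : p ∈ tsupport (fun p => c p * φ p)
    swap
    · exact contDiffAt_const.congr_of_eventuallyEq (notMem_tsupport_iff_eventuallyEq.1 hp)
    have hpΩ := hφ.2.2 (hts hp)
    exact (hcd.contDiffAt (hΩ.mem_nhds hpΩ)).mul (hφ.1.of_le (by norm_cast)).contDiffAt
  have hcs : HasCompactSupport (fun p => c p * φ p) := hφ.2.1.mul_left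
  have e := integral_mul_fderiv_of_contDiff_one hΩ hf hg h hχ hcs (hts.trans hφ.2.2)
  have hdφ : Continuous (fun p => fderiv ℝ φ p v) :=
    (hφ.1.continuous_fderiv (by simp)).clm_apply continuous_const
  have i₀ := integrableOn_mul_of_tsupport_subset l₀ hdφ
    (hφ.2.1.mono' (subset_closure.trans (tsupport_fderiv_apply_subset φ v)))
    ((tsupport_fderiv_apply_subset φ v).trans hφ.2.2)
  have e₁ : ∫ p in Ω, f p * fderiv ℝ (fun p => c p * φ p) p v
      = (∫ p in Ω, (c p * f p) * fderiv ℝ φ p v) + ∫ p in Ω, (fderiv ℝ c p v * f p) * φ p := by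
    rw [← integral_add i₀ (hφ.integrableOn_mul l₁)]
    refine setIntegral_congr_fun hΩ.measurableSet fun p hp => ?_
    have d₁ := (hcd.differentiableOn one_ne_zero).differentiableAt (hΩ.mem_nhds hp)
    have d₂ : DifferentiableAt ℝ φ p := (hφ.1.differentiable (by simp)).differentiableAt
    simp only [fderiv_fun_mul d₁ d₂, add_apply,
      smul_apply, smul_eq_mul]
    ring
  have e₂ : ∫ p in Ω, (fderiv ℝ c p v * f p + c p * g p) * φ p
      = (∫ p in Ω, (fderiv ℝ c p v * f p) * φ p) + ∫ p in Ω, g p * (c p * φ p) := by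
    rw [← integral_add (hφ.integrableOn_mul l₁)]
    · exact integral_congr_ae (ae_of_all _ fun p => by ring)
    · exact (hφ.integrableOn_mul l₂).congr (ae_of_all _ fun p => by ring)
  rw [e₂]
  linarith

theorem isWeakDeriv_one_zero_iff : IsWeakDeriv Ω 1 0 f g ↔ LocallyIntegrableOn f Ω ∧
    LocallyIntegrableOn g Ω ∧ ∀ φ, IsTestFunction Ω φ →
      ∫ p in Ω, f p * fderiv ℝ φ p (1, 0) = -∫ p in Ω, g p * φ p := by
  simp [IsWeakDeriv, dx]

theorem isWeakDeriv_zero_one_iff : IsWeakDeriv Ω 0 1 f g ↔ LocallyIntegrableOn f Ω ∧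
    LocallyIntegrableOn g Ω ∧ ∀ φ, IsTestFunction Ω φ →
      ∫ p in Ω, f p * fderiv ℝ φ p (0, 1) = -∫ p in Ω, g p * φ p := by
  simp [IsWeakDeriv, dy]

theorem IsWeakDeriv.mul_dx (hΩ : IsOpen Ω) {c : ℝ × ℝ → ℝ} (hc : ContDiffOn ℝ 1 c Ω)
    (h : IsWeakDeriv Ω 1 0 f g) :
    IsWeakDeriv Ω 1 0 (fun p => c p * f p) (fun p => dx c p * f p + c p * g p) := by
  rw [isWeakDeriv_one_zero_iff] at h ⊢
  exact integral_product_rule hΩ hc h.1 h.2.1 h.2.2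

theorem IsWeakDeriv.mul_dy (hΩ : IsOpen Ω) {c : ℝ × ℝ → ℝ} (hc : ContDiffOn ℝ 1 c Ω)
    (h : IsWeakDeriv Ω 0 1 f g) :
    IsWeakDeriv Ω 0 1 (fun p => c p * f p) (fun p => dy c p * f p + c p * g p) := by
  rw [isWeakDeriv_zero_one_iff] at h ⊢
  exact integral_product_rule hΩ hc h.1 h.2.1 h.2.2

end ProductRule

/-! ### The spaces `H ^ k` -/

section Sobolev

variable {Ω : Set (ℝ × ℝ)} {f g : ℝ × ℝ → ℝ} {k : ℕ}

theorem locallyIntegrableOn_of_memLp (hf : MemLp f 2 (volume.restrict Ω)) :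
    LocallyIntegrableOn f Ω :=
  locallyIntegrableOn_of_locallyIntegrable_restrict (hf.locallyIntegrable (by norm_num))

theorem memH_zero (hf : MemLp f 2 (volume.restrict Ω)) : MemH 0 Ω f := by
  refine ⟨hf, fun i j hij => ?_⟩
  obtain ⟨rfl, rfl⟩ : i = 0 ∧ j = 0 := by omega
  exact ⟨f, hf, isWeakDeriv_self (locallyIntegrableOn_of_memLp hf)⟩

theorem memH_succ {fx fy : ℝ × ℝ → ℝ} (hf : MemLp f 2 (volume.restrict Ω))
    (hx : IsWeakDeriv Ω 1 0 f fx) (hy : IsWeakDeriv Ω 0 1 f fy)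
    (hfx : MemH k Ω fx) (hfy : MemH k Ω fy) : MemH (k + 1) Ω f := by
  refine ⟨hf, fun i j hij => ?_⟩
  rcases i with _ | i
  · rcases j with _ | j
    · exact ⟨f, hf, isWeakDeriv_self (locallyIntegrableOn_of_memLp hf)⟩
    · obtain ⟨g, hg, hd⟩ := hfy.2 0 j (by omega)
      refine ⟨g, hg, ?_⟩
      have := hy.trans hd
      rwa [add_comm 1 j] at this
  · obtain ⟨g, hg, hd⟩ := hfx.2 i j (by omega)
    refine ⟨g, hg, ?_⟩
    have := hx.trans hd
    rwa [add_comm 1 i, zero_add] at this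

theorem MemH.mono {l : ℕ} (h : MemH k Ω f) (hl : l ≤ k) : MemH l Ω f :=
  ⟨h.1, fun i j hij => h.2 i j (hij.trans hl)⟩

theorem MemH.congr (h : MemH k Ω f) (hfg : f =ᵐ[volume.restrict Ω] g) : MemH k Ω g := by
  refine ⟨h.1.ae_eq hfg, fun i j hij => ?_⟩
  obtain ⟨d, hd, hw⟩ := h.2 i j hij
  exact ⟨d, hd, hw.congr hfg (ae_eq_refl _)⟩

theorem MemH.add (hf : MemH k Ω f) (hg : MemH k Ω g) : MemH k Ω (fun p => f p + g p) := by
  refine ⟨hf.1.add hg.1, fun i j hij => ?_⟩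
  obtain ⟨d, hd, hw⟩ := hf.2 i j hij
  obtain ⟨d', hd', hw'⟩ := hg.2 i j hij
  exact ⟨_, hd.add hd', hw.add hw'⟩

theorem MemH.isWeakDeriv_weakD (hf : MemH k Ω f) {i j : ℕ} (hij : i + j ≤ k) :
    IsWeakDeriv Ω i j f (weakD Ω i j f) :=
  (hf.2 i j hij).choose_spec.2.weakD

theorem MemH.weakD {i j : ℕ} (hΩ : IsOpen Ω) (hf : MemH k Ω f) {l : ℕ} (hl : i + j + l ≤ k) :
    MemH l Ω (weakD Ω i j f) := by
  obtain ⟨d, hd, hw⟩ := hf.2 i j (by omega)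
  have hae := hw.weakD_ae_eq hΩ
  refine ⟨hd.ae_eq hae.symm, fun a b hab => ?_⟩
  obtain ⟨d', hd', hw'⟩ := hf.2 (i + a) (j + b) (by omega)
  exact ⟨d', hd', hw.weakD.of_trans hw'⟩

theorem MemH.weakLap (hΩ : IsOpen Ω) (hf : MemH k Ω f) {l : ℕ} (hl : l + 2 ≤ k) :
    MemH l Ω (weakLap Ω f) :=
  (hf.weakD hΩ (by omega)).add (hf.weakD hΩ (by omega))

theorem memLp_continuousOn_mul {c : ℝ × ℝ → ℝ} (hΩ : IsOpen Ω) (hcpt : IsCompact (closure Ω))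
    (hc : ContinuousOn c (closure Ω)) (hf : MemLp f 2 (volume.restrict Ω)) :
    MemLp (fun p => c p * f p) 2 (volume.restrict Ω) := by
  obtain ⟨C, hC⟩ := hcpt.exists_bound_of_continuousOn hc
  refine hf.of_le_mul (c := C)
    (((hc.mono subset_closure).aestronglyMeasurable hΩ.measurableSet).mul hf.1) ?_
  filter_upwards [ae_restrict_mem hΩ.measurableSet] with p hp
  rw [norm_mul]
  exact mul_le_mul_of_nonneg_right (hC p (subset_closure hp)) (norm_nonneg _)

/-- On a bounded domain, `H ^ k` is stable under multiplication by functions of class `C ^ k`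
up to the boundary. -/
theorem MemH.contDiffOn_mul (hΩ : IsOpen Ω) (hcpt : IsCompact (closure Ω))
    (hu : UniqueDiffOn ℝ (closure Ω)) {c : ℝ × ℝ → ℝ} (hc : ContDiffOn ℝ k c (closure Ω))
    (hf : MemH k Ω f) : MemH k Ω (fun p => c p * f p) := by
  induction k generalizing f c with
  | zero => exact memH_zero (memLp_continuousOn_mul hΩ hcpt hc.continuousOn hf.1)
  | succ k ih =>
    have hck : ContDiffOn ℝ k c (closure Ω) := hc.of_le (by norm_cast; omega)
    have hc1 : ContDiffOn ℝ 1 c Ω := (hc.of_le (by norm_cast; omega)).mono subset_closure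
    have hd : ∀ v, ContDiffOn ℝ k (fun p => fderivWithin ℝ c (closure Ω) p v) (closure Ω) :=
      fun v => (hc.fderivWithin hu (by norm_cast)).clm_apply contDiffOn_const
    have hdeq : ∀ v, ∀ p ∈ Ω, fderivWithin ℝ c (closure Ω) p v = fderiv ℝ c p v :=
      fun v p hp => by
        rw [fderivWithin_of_mem_nhds (mem_of_superset (hΩ.mem_nhds hp) subset_closure)]
    have hae : ∀ (v : ℝ × ℝ) (g : ℝ × ℝ → ℝ),
        (fun p => fderivWithin ℝ c (closure Ω) p v * f p + c p * g p) =ᵐ[volume.restrict Ω]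
          fun p => fderiv ℝ c p v * f p + c p * g p := fun v g => by
      filter_upwards [ae_restrict_mem hΩ.measurableSet] with p hp
      rw [hdeq v p hp]
    refine memH_succ (memLp_continuousOn_mul hΩ hcpt hc.continuousOn hf.1)
      ((hf.isWeakDeriv_weakD (i := 1) (j := 0) (by omega)).mul_dx hΩ hc1)
      ((hf.isWeakDeriv_weakD (i := 0) (j := 1) (by omega)).mul_dy hΩ hc1) ?_ ?_
    · exact ((ih (hd _) (hf.mono (by omega))).add
        (ih hck (hf.weakD hΩ (by omega)))).congr (hae _ _)
    · exact ((ih (hd _) (hf.mono (by omega))).add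
        (ih hck (hf.weakD hΩ (by omega)))).congr (hae _ _)

end Sobolev

/-! ### The disc and the half disc -/

theorem isOpen_disc : IsOpen disc :=
  isOpen_lt (by fun_prop) continuous_const

theorem isOpen_halfDisc : IsOpen halfDisc :=
  IsOpen.inter (s := disc) (t := {p | 0 < p.2}) isOpen_disc
    (isOpen_lt continuous_const continuous_snd)

theorem halfDisc_subset_disc : halfDisc ⊆ disc := fun _ hp => hp.1

theorem disc_subset_Icc : disc ⊆ Icc (-1) 1 ×ˢ Icc (-1) 1 := by
  rintro ⟨x, y⟩ h
  have h : x ^ 2 + y ^ 2 < 1 := h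
  have h₁ : |x| ≤ 1 := by
    rw [← sq_le_one_iff_abs_le_one]; nlinarith [sq_nonneg y]
  have h₂ : |y| ≤ 1 := by
    rw [← sq_le_one_iff_abs_le_one]; nlinarith [sq_nonneg x]
  exact ⟨abs_le.1 h₁, abs_le.1 h₂⟩

theorem isCompact_closure_halfDisc : IsCompact (closure halfDisc) :=
  (isCompact_Icc.prod isCompact_Icc).closure_of_subset
    (halfDisc_subset_disc.trans disc_subset_Icc)

theorem convex_halfDisc : Convex ℝ halfDisc := by
  rintro ⟨x, y⟩ ⟨h, hy⟩ ⟨x', y'⟩ ⟨h', hy'⟩ s t hs ht hst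
  simp only at h hy h' hy'
  obtain rfl : t = 1 - s := by linarith
  constructor
  · simp only [Prod.smul_mk, smul_eq_mul, Prod.mk_add_mk]
    have e : (s * x + (1 - s) * x') ^ 2 + (s * y + (1 - s) * y') ^ 2
        = s * (x ^ 2 + y ^ 2) + (1 - s) * (x' ^ 2 + y' ^ 2)
          - s * (1 - s) * ((x - x') ^ 2 + (y - y') ^ 2) := by ring
    have e' : 0 ≤ s * (1 - s) * ((x - x') ^ 2 + (y - y') ^ 2) := by positivity
    rcases hs.eq_or_lt with rfl | hs
    · simpa using h'
    · nlinarith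
  · simp only [Prod.smul_mk, smul_eq_mul, Prod.mk_add_mk]
    rcases hs.eq_or_lt with rfl | hs
    · simpa using hy'
    · have := mul_pos hs hy
      have := mul_nonneg ht hy'.le
      linarith

theorem uniqueDiffOn_closure_halfDisc : UniqueDiffOn ℝ (closure halfDisc) := by
  refine uniqueDiffOn_convex convex_halfDisc.closure ⟨(0, 1 / 2), ?_⟩
  refine mem_interior.2 ⟨halfDisc, subset_closure, isOpen_halfDisc, ?_, ?_⟩ <;> norm_num

theorem volume_disc_lt_top : volume disc < ⊤ :=
  (measure_mono disc_subset_Icc).trans_lt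
    (isCompact_Icc.prod isCompact_Icc).measure_lt_top

theorem volume_halfDisc_lt_top : volume halfDisc < ⊤ :=
  (measure_mono halfDisc_subset_disc).trans_lt volume_disc_lt_top

theorem integrableOn_halfDisc_of_memLp {f : ℝ × ℝ → ℝ}
    (hf : MemLp f 2 (volume.restrict halfDisc)) : IntegrableOn f halfDisc := by
  have : IsFiniteMeasure (volume.restrict halfDisc) := ⟨by simpa using volume_halfDisc_lt_top⟩
  exact hf.integrable (by norm_num)

theorem IntegrableOn.mul_continuous_compactSupport {s : Set (ℝ × ℝ)} {f χ : ℝ × ℝ → ℝ}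
    (hf : IntegrableOn f s) (hχ : Continuous χ) (hc : HasCompactSupport χ) :
    IntegrableOn (fun p => f p * χ p) s := by
  obtain ⟨C, hC⟩ := hc.exists_bound_of_continuous hχ
  exact hf.mul_bdd (c := C) hχ.aestronglyMeasurable (ae_of_all _ hC)

/-! ### Cutting off near the axis -/

/-- A smooth transition from `0` on `(-∞, 1]` to `1` on `[2, ∞)`. -/
def cutoff (s : ℝ) : ℝ := Real.smoothTransition (s - 1)

theorem contDiff_cutoff : ContDiff ℝ ∞ cutoff :=
  Real.smoothTransition.contDiff.comp (contDiff_id.sub contDiff_const)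

theorem cutoff_of_le {s : ℝ} (h : s ≤ 1) : cutoff s = 0 :=
  Real.smoothTransition.zero_of_nonpos (by linarith)

theorem cutoff_of_ge {s : ℝ} (h : 2 ≤ s) : cutoff s = 1 :=
  Real.smoothTransition.one_of_one_le (by linarith)

theorem abs_cutoff_le (s : ℝ) : |cutoff s| ≤ 1 := by
  rw [cutoff, abs_of_nonneg (Real.smoothTransition.nonneg _)]
  exact Real.smoothTransition.le_one _

theorem deriv_cutoff_of_gt {s : ℝ} (h : 2 < s) : deriv cutoff s = 0 := by
  have : cutoff =ᶠ[𝓝 s] fun _ => 1 :=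
    (eventually_gt_nhds h).mono fun t ht => cutoff_of_ge ht.le
  rw [this.deriv_eq, deriv_const]

theorem deriv_cutoff_of_lt {s : ℝ} (h : s < 1) : deriv cutoff s = 0 := by
  have : cutoff =ᶠ[𝓝 s] fun _ => 0 :=
    (eventually_lt_nhds h).mono fun t ht => cutoff_of_le ht.le
  rw [this.deriv_eq, deriv_const]

theorem continuous_deriv_cutoff : Continuous (deriv cutoff) :=
  contDiff_cutoff.continuous_deriv (by norm_num)

theorem exists_abs_deriv_cutoff_le : ∃ M, 0 ≤ M ∧ ∀ s, |deriv cutoff s| ≤ M := by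
  have hc : HasCompactSupport (deriv cutoff) := by
    refine HasCompactSupport.intro (isCompact_Icc (a := (1 : ℝ)) (b := 2)) fun s hs => ?_
    rw [mem_Icc, not_and_or, not_le, not_le] at hs
    exact hs.elim deriv_cutoff_of_lt deriv_cutoff_of_gt
  obtain ⟨C, hC⟩ := hc.exists_bound_of_continuous continuous_deriv_cutoff
  exact ⟨C, (norm_nonneg _).trans (hC 0), hC⟩

section Cutoff

variable {φ f g : ℝ × ℝ → ℝ}

theorem contDiff_cutoff_mul (n : ℕ) : ContDiff ℝ ∞ (fun p : ℝ × ℝ => cutoff (n * p.2)) :=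
  contDiff_cutoff.comp (contDiff_const.mul contDiff_snd)

theorem fderiv_cutoff_mul (n : ℕ) (hφ : ContDiff ℝ ∞ φ) (p v : ℝ × ℝ) :
    fderiv ℝ (fun p => cutoff (n * p.2) * φ p) p v
      = cutoff (n * p.2) * fderiv ℝ φ p v
        + φ p * (n * deriv cutoff (n * p.2)) * v.2 := by
  have d₁ : HasFDerivAt (fun p : ℝ × ℝ => cutoff (n * p.2))
      (deriv cutoff (n * p.2) • ((n : ℝ) • ContinuousLinearMap.snd ℝ ℝ ℝ)) p := by
    have h₁ : HasDerivAt cutoff (deriv cutoff (n * p.2)) (n * p.2) :=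
      (contDiff_cutoff.differentiable (by simp)).differentiableAt.hasDerivAt
    have h₂ : HasFDerivAt (fun p : ℝ × ℝ => (n : ℝ) * p.2)
        ((n : ℝ) • ContinuousLinearMap.snd ℝ ℝ ℝ) p := hasFDerivAt_snd.const_mul (n : ℝ)
    exact HasDerivAt.comp_hasFDerivAt (h₂ := cutoff) p h₁ h₂
  have d₂ : HasFDerivAt φ (fderiv ℝ φ p) p :=
    (hφ.differentiable (by simp)).differentiableAt.hasFDerivAt
  rw [(d₁.fun_mul d₂).fderiv]
  simp only [add_apply, smul_apply, smul_eq_mul, ContinuousLinearMap.coe_snd']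
  ring

theorem IsTestFunction.cutoff_mul {n : ℕ} (hn : 0 < n) (hφ : IsTestFunction disc φ) :
    IsTestFunction halfDisc (fun p => cutoff (n * p.2) * φ p) := by
  have hn' : (0 : ℝ) < n := by exact_mod_cast hn
  refine ⟨(contDiff_cutoff_mul n).mul hφ.1, hφ.2.1.mul_left, fun p hp => ?_⟩
  have h₁ : p ∈ disc := hφ.2.2 (tsupport_mul_subset_right hp)
  have h₂ : tsupport (fun p => cutoff (n * p.2) * φ p) ⊆ {p : ℝ × ℝ | 1 ≤ n * p.2} := by
    refine closure_minimal (fun q hq => ?_) (isClosed_le continuous_const (by fun_prop))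
    by_contra h
    exact hq (by simp [cutoff_of_le (not_le.1 h).le])
  have h₃ : 1 ≤ n * p.2 := h₂ hp
  exact ⟨h₁, by by_contra h; nlinarith⟩

theorem tendsto_setIntegral_mul_cutoff {χ : ℝ × ℝ → ℝ}
    (hχ : IntegrableOn (fun p => f p * χ p) halfDisc) :
    Tendsto (fun n : ℕ => ∫ p in halfDisc, f p * (cutoff (n * p.2) * χ p)) atTop
      (𝓝 (∫ p in halfDisc, f p * χ p)) := by
  have e : ∀ n : ℕ, ∀ p : ℝ × ℝ, f p * (cutoff (n * p.2) * χ p)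
      = cutoff (n * p.2) * (f p * χ p) := fun n p => by ring
  simp_rw [e]
  refine tendsto_integral_of_dominated_convergence (fun p => |f p * χ p|) (fun n => ?_)
    hχ.abs (fun n => ae_of_all _ fun p => ?_) ?_
  · exact (contDiff_cutoff_mul n).continuous.aestronglyMeasurable.mul hχ.1
  · rw [norm_mul]
    exact mul_le_of_le_one_left (abs_nonneg _) (abs_cutoff_le _)
  · filter_upwards [ae_restrict_mem isOpen_halfDisc.measurableSet] with p hp
    refine tendsto_const_nhds.congr' ?_
    obtain ⟨N, hN⟩ := exists_nat_ge (2 / p.2)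
    filter_upwards [eventually_ge_atTop N] with n hn
    rw [cutoff_of_ge, one_mul]
    rw [div_le_iff₀ hp.2] at hN
    have : (N : ℝ) ≤ n := by exact_mod_cast hn
    nlinarith [hp.2]

/-- Integration by parts along the axis: as cutting off near the axis does not interact with
differentiation in `x`, the test function need not vanish on the axis. -/
theorem IsWeakDeriv.integral_mul_dx (h : IsWeakDeriv halfDisc 1 0 f g)
    (hf : IntegrableOn f halfDisc) (hg : IntegrableOn g halfDisc) (hφ : IsTestFunction disc φ) :
    ∫ p in halfDisc, f p * dx φ p = -∫ p in halfDisc, g p * φ p := by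
  have h₁ := tendsto_setIntegral_mul_cutoff
    (IntegrableOn.mul_continuous_compactSupport hf hφ.dx.1.continuous hφ.dx.2.1)
  have h₂ := (tendsto_setIntegral_mul_cutoff
    (IntegrableOn.mul_continuous_compactSupport hg hφ.1.continuous hφ.2.1)).neg
  refine tendsto_nhds_unique h₁ (h₂.congr' ?_)
  filter_upwards [eventually_gt_atTop 0] with n hn
  rw [← (isWeakDeriv_one_zero_iff.1 h).2.2 _ (hφ.cutoff_mul hn)]
  refine integral_congr_ae (ae_of_all _ fun p => ?_)
  simp only [fderiv_cutoff_mul n hφ.1, mul_zero, add_zero, dx]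

/-- Integration by parts across the axis is valid if the contribution of the layer in which the
cutoff varies is asymptotically negligible. -/
theorem IsWeakDeriv.integral_mul_dy_of_tendsto (h : IsWeakDeriv halfDisc 0 1 f g)
    (hf : IntegrableOn f halfDisc) (hg : IntegrableOn g halfDisc) (hφ : IsTestFunction disc φ)
    (ht : Tendsto (fun n : ℕ => ∫ p in halfDisc, f p * (φ p * (n * deriv cutoff (n * p.2))))
      atTop (𝓝 0)) :
    ∫ p in halfDisc, f p * dy φ p = -∫ p in halfDisc, g p * φ p := by
  have h₁ := (tendsto_setIntegral_mul_cutoff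
    (IntegrableOn.mul_continuous_compactSupport hf hφ.dy.1.continuous hφ.dy.2.1)).add ht
  have h₂ := (tendsto_setIntegral_mul_cutoff
    (IntegrableOn.mul_continuous_compactSupport hg hφ.1.continuous hφ.2.1)).neg
  rw [add_zero] at h₁
  refine tendsto_nhds_unique h₁ (h₂.congr' ?_)
  filter_upwards [eventually_gt_atTop 0] with n hn
  rw [← (isWeakDeriv_zero_one_iff.1 h).2.2 _ (hφ.cutoff_mul hn), ← integral_add]
  · refine integral_congr_ae (ae_of_all _ fun p => ?_)
    simp only [fderiv_cutoff_mul n hφ.1, dy]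
    ring
  · exact IntegrableOn.mul_continuous_compactSupport hf
      ((contDiff_cutoff_mul n).continuous.mul hφ.dy.1.continuous) hφ.dy.2.1.mul_left
  · refine IntegrableOn.mul_continuous_compactSupport hf
      (hφ.1.continuous.mul (continuous_const.mul (continuous_deriv_cutoff.comp (by fun_prop))))
      hφ.2.1.mul_right

/-- Test functions that vanish on the axis need not be supported away from it. -/
theorem IsWeakDeriv.integral_mul_dy_of_eq_zero (h : IsWeakDeriv halfDisc 0 1 f g)
    (hf : IntegrableOn f halfDisc) (hg : IntegrableOn g halfDisc) (hφ : IsTestFunction disc φ)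
    (h0 : ∀ x, φ (x, 0) = 0) :
    ∫ p in halfDisc, f p * dy φ p = -∫ p in halfDisc, g p * φ p := by
  refine h.integral_mul_dy_of_tendsto hf hg hφ ?_
  obtain ⟨M, hM0, hM⟩ := exists_abs_deriv_cutoff_le
  obtain ⟨K, hK⟩ := hφ.1.lipschitzWith_of_hasCompactSupport hφ.2.1 (by simp)
  have hφy : ∀ p : ℝ × ℝ, |φ p| ≤ K * |p.2| := fun p => by
    have := hK.dist_le_mul p (p.1, 0)
    rwa [Real.dist_eq, h0, sub_zero, Prod.dist_eq, dist_self, Real.dist_eq, sub_zero,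
      max_eq_right (abs_nonneg _)] at this
  -- On the layer `n * y ≤ 2` the derivative of the cutoff, of size `n`, is compensated by `φ`.
  have hb : ∀ (n : ℕ) (p : ℝ × ℝ), p ∈ halfDisc →
      |φ p * (n * deriv cutoff (n * p.2))| ≤ K * (2 * M) := by
    intro n p hp
    have hp2 : 0 < p.2 := hp.2
    rw [abs_mul, abs_mul, Nat.abs_cast]
    by_cases hn : 2 < n * p.2
    · rw [deriv_cutoff_of_gt hn, abs_zero, mul_zero, mul_zero]
      positivity
    · calc |φ p| * (n * |deriv cutoff (n * p.2)|) ≤ (K * |p.2|) * (n * M) := by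
            gcongr
            · exact hφy p
            · exact hM _
        _ = K * ((n * p.2) * M) := by rw [abs_of_pos hp2]; ring
        _ ≤ _ := by gcongr; exact not_lt.1 hn
  rw [← integral_zero (ℝ × ℝ) ℝ (μ := volume.restrict halfDisc)]
  refine tendsto_integral_of_dominated_convergence (fun p => |f p| * (K * (2 * M)))
    (fun n => ?_) (hf.abs.mul_const _) (fun n => ?_) ?_
  · exact hf.1.mul (hφ.1.continuous.mul (continuous_const.mul
      (continuous_deriv_cutoff.comp (by fun_prop)))).aestronglyMeasurable
  · filter_upwards [ae_restrict_mem isOpen_halfDisc.measurableSet] with p hp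
    rw [norm_mul]
    exact mul_le_mul_of_nonneg_left (hb n p hp) (norm_nonneg _)
  · filter_upwards [ae_restrict_mem isOpen_halfDisc.measurableSet] with p hp
    refine tendsto_const_nhds.congr' ?_
    obtain ⟨N, hN⟩ := exists_nat_gt (2 / p.2)
    filter_upwards [eventually_ge_atTop N] with n hn
    rw [deriv_cutoff_of_gt, mul_zero, mul_zero, mul_zero]
    rw [div_lt_iff₀ hp.2] at hN
    have : (N : ℝ) ≤ n := by exact_mod_cast hn
    nlinarith [hp.2]

/-- If `f` has boundary values `0` on the axis, then on compact subsets of the disc it is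
uniformly small in a layer along the axis. -/
theorem exists_layer_abs_le (hbd : ∀ x ∈ Ioo (-1 : ℝ) 1, HasBoundaryValue halfDisc f (x, 0) 0)
    {K : Set (ℝ × ℝ)} (hK : IsCompact K) (hKd : K ⊆ disc) {ε : ℝ} (hε : 0 < ε) :
    ∃ δ > 0, ∀ᵐ p ∂(volume.restrict halfDisc), p ∈ K → p.2 < δ → |f p| ≤ ε := by
  refine hK.induction_on (p := fun s => ∃ δ > 0, ∀ᵐ p ∂(volume.restrict halfDisc),
    p ∈ s → p.2 < δ → |f p| ≤ ε) ⟨1, one_pos, by simp⟩ ?_ ?_ ?_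
  · rintro s t hst ⟨δ, hδ, h⟩
    exact ⟨δ, hδ, h.mono fun p hp hps => hp (hst hps)⟩
  · rintro s t ⟨δ, hδ, h⟩ ⟨δ', hδ', h'⟩
    refine ⟨min δ δ', lt_min hδ hδ', ?_⟩
    filter_upwards [h, h'] with p hp hp' hpst hlt
    exact hpst.elim (fun hs => hp hs (hlt.trans_le (min_le_left _ _)))
      (fun ht => hp' ht (hlt.trans_le (min_le_right _ _)))
  · rintro ⟨x, y⟩ hxy
    rcases eq_or_ne y 0 with rfl | hy
    · have hx : x ∈ Ioo (-1 : ℝ) 1 := by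
        have h : x ^ 2 + (0 : ℝ) ^ 2 < 1 := hKd hxy
        exact abs_lt.1 ((sq_lt_one_iff_abs_lt_one x).1 (by linarith))
      have hev : ∀ᶠ p in 𝓝 (x, (0 : ℝ)) ⊓ ae (volume.restrict halfDisc), |f p| ≤ ε := by
        have := (hbd x hx).eventually (Metric.closedBall_mem_nhds (0 : ℝ) hε)
        simpa using this
      rw [eventually_inf] at hev
      obtain ⟨s, hs, t, ht, h⟩ := hev
      refine ⟨s, mem_nhdsWithin_of_mem_nhds hs, 1, one_pos, ?_⟩
      filter_upwards [ht] with p hpt hps _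
      exact h p ⟨hps, hpt⟩
    · have hy' : 0 < |y| := abs_pos.2 hy
      refine ⟨{p | |y| / 2 < |p.2|}, mem_nhdsWithin_of_mem_nhds ?_, |y| / 2, by positivity, ?_⟩
      · exact (isOpen_lt continuous_const (by fun_prop)).mem_nhds (by simp [hy])
      · filter_upwards [ae_restrict_mem isOpen_halfDisc.measurableSet] with p hp h₁ h₂
        have h₁ : |y| / 2 < |p.2| := h₁
        rw [abs_of_pos hp.2] at h₁
        exact absurd h₁ h₂.le.not_gt

/-- Functions with boundary values `0` on the axis can be integrated by parts against test
functions that do not vanish on the axis. -/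
theorem IsWeakDeriv.integral_mul_dy_of_hasBoundaryValue (h : IsWeakDeriv halfDisc 0 1 f g)
    (hf : IntegrableOn f halfDisc) (hg : IntegrableOn g halfDisc) (hφ : IsTestFunction disc φ)
    (hbd : ∀ x ∈ Ioo (-1 : ℝ) 1, HasBoundaryValue halfDisc f (x, 0) 0) :
    ∫ p in halfDisc, f p * dy φ p = -∫ p in halfDisc, g p * φ p := by
  refine h.integral_mul_dy_of_tendsto hf hg hφ ?_
  obtain ⟨M, hM0, hM⟩ := exists_abs_deriv_cutoff_le
  obtain ⟨C, hC⟩ := hφ.2.1.exists_bound_of_continuous hφ.1.continuous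
  have hC0 : 0 ≤ C := (norm_nonneg _).trans (hC 0)
  rw [Metric.tendsto_atTop]
  intro ε hε
  obtain ⟨δ, hδ, hsmall⟩ := exists_layer_abs_le hbd hφ.2.1 hφ.2.2
    (ε := ε / (4 * (C * M) + 1)) (by positivity)
  obtain ⟨N, hN⟩ := exists_nat_gt (2 / δ)
  refine ⟨N + 1, fun n hn => ?_⟩
  have hn0 : (0 : ℝ) < n := by exact_mod_cast (by omega : 0 < n)
  have hnδ : 2 < n * δ := by
    rw [div_lt_iff₀ hδ] at hN
    have : (N : ℝ) ≤ n := by exact_mod_cast (by omega : N ≤ n)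
    nlinarith
  -- The layer has area of order `1 / n`, which compensates the size `n` of the derivative of the
  -- cutoff; the smallness comes from `f`.
  set S : Set (ℝ × ℝ) := Icc (-1 : ℝ) 1 ×ˢ Icc (0 : ℝ) (2 / n) with hS
  have hSm : MeasurableSet S := measurableSet_Icc.prod measurableSet_Icc
  have hSv : volume.real S = 4 / n := by
    rw [hS, Measure.volume_eq_prod, measureReal_prod_prod, Real.volume_real_Icc_of_le (by norm_num),
      Real.volume_real_Icc_of_le (by positivity)]
    ring
  have hSfin : volume S < ⊤ := (isCompact_Icc.prod isCompact_Icc).measure_lt_top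
  set B := ε / (4 * (C * M) + 1) * (C * (n * M)) with hB
  have hB0 : 0 ≤ B := by positivity
  have hbound : ∀ᵐ p ∂(volume.restrict halfDisc),
      ‖f p * (φ p * (n * deriv cutoff (n * p.2)))‖ ≤ S.indicator (fun _ => B) p := by
    filter_upwards [hsmall, ae_restrict_mem isOpen_halfDisc.measurableSet] with p hp hpH
    have hp2 : 0 < p.2 := hpH.2
    by_cases hpS : p ∈ S
    · rw [indicator_of_mem hpS]
      by_cases hpφ : p ∈ tsupport φ
      · have hpy : p.2 < δ := by
          have : p.2 ≤ 2 / n := hpS.2.2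
          rw [le_div_iff₀ hn0] at this
          by_contra hcon
          nlinarith
        rw [norm_mul, norm_mul, norm_mul, Real.norm_natCast]
        have := hp hpφ hpy
        rw [hB]
        gcongr
        · exact this
        · exact hC p
        · exact hM _
      · rw [image_eq_zero_of_notMem_tsupport hpφ, zero_mul, mul_zero, norm_zero]
        exact hB0
    · have hpn : 2 < n * p.2 := by
        by_contra hcon
        refine hpS ⟨(disc_subset_Icc hpH.1).1, hp2.le, ?_⟩
        rw [le_div_iff₀ hn0]
        linarith
      rw [deriv_cutoff_of_gt hpn, mul_zero, mul_zero, mul_zero, norm_zero, indicator_of_notMem hpS]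
  have hint : Integrable (S.indicator fun _ => B) (volume : Measure (ℝ × ℝ)) :=
    (integrable_indicator_iff hSm).2 (integrableOn_const hSfin.ne)
  rw [dist_zero_right]
  calc _ ≤ ∫ p in halfDisc, S.indicator (fun _ => B) p :=
        norm_integral_le_of_norm_le hint.integrableOn hbound
    _ ≤ ∫ p, S.indicator (fun _ => B) p :=
        setIntegral_le_integral hint (ae_of_all _ fun p => indicator_nonneg (fun _ _ => hB0) p)
    _ = 4 / n * B := by rw [integral_indicator hSm, setIntegral_const, hSv, smul_eq_mul]
    _ = ε * (4 * (C * M) / (4 * (C * M) + 1)) := by rw [hB]; field_simp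
    _ < ε := by
        refine mul_lt_of_lt_one_right hε ?_
        rw [div_lt_one (by positivity)]
        linarith

end Cutoff

/-! ### Vanishing traces -/

section ZeroTrace

variable {f g h f' g' φ : ℝ × ℝ → ℝ}

/-- The extension by zero of a function on the half disc. -/
def zeroExt (f : ℝ × ℝ → ℝ) : ℝ × ℝ → ℝ := halfDisc.indicator f

theorem zeroExt_add (f g : ℝ × ℝ → ℝ) :
    zeroExt (fun p => f p + g p) = fun p => zeroExt f p + zeroExt g p :=
  indicator_add _ _ _

theorem zeroExt_const_mul (c : ℝ) (f : ℝ × ℝ → ℝ) :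
    zeroExt (fun p => c * f p) = fun p => c * zeroExt f p :=
  indicator_const_smul _ c f

theorem integrable_zeroExt (hf : IntegrableOn f halfDisc) : Integrable (zeroExt f) :=
  (integrable_indicator_iff isOpen_halfDisc.measurableSet).2 hf

theorem locallyIntegrableOn_zeroExt (hf : IntegrableOn f halfDisc) (s : Set (ℝ × ℝ)) :
    LocallyIntegrableOn (zeroExt f) s :=
  (integrable_zeroExt hf).locallyIntegrable.locallyIntegrableOn s

theorem setIntegral_zeroExt_mul (f φ : ℝ × ℝ → ℝ) :
    ∫ p in disc, zeroExt f p * φ p = ∫ p in halfDisc, f p * φ p := by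
  have : ∀ p, zeroExt f p * φ p = halfDisc.indicator (fun p => f p * φ p) p := fun p =>
    (indicator_mul_left halfDisc f φ).symm
  simp_rw [this]
  rw [setIntegral_indicator isOpen_halfDisc.measurableSet,
    inter_eq_self_of_subset_right halfDisc_subset_disc]

/-- Extension by zero across the axis preserves the weak derivative along the axis. -/
theorem IsWeakDeriv.zeroExt_dx (h : IsWeakDeriv halfDisc 1 0 f g) (hf : IntegrableOn f halfDisc)
    (hg : IntegrableOn g halfDisc) : IsWeakDeriv disc 1 0 (zeroExt f) (zeroExt g) := by
  refine isWeakDeriv_one_zero_iff.2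
    ⟨locallyIntegrableOn_zeroExt hf _, locallyIntegrableOn_zeroExt hg _, fun φ hφ => ?_⟩
  rw [setIntegral_zeroExt_mul, setIntegral_zeroExt_mul]
  exact h.integral_mul_dx hf hg hφ

theorem isWeakDeriv_zeroExt_dy (hf : IntegrableOn f halfDisc) (hg : IntegrableOn g halfDisc)
    (h : ∀ φ, IsTestFunction disc φ →
      ∫ p in halfDisc, f p * dy φ p = -∫ p in halfDisc, g p * φ p) :
    IsWeakDeriv disc 0 1 (zeroExt f) (zeroExt g) := by
  refine isWeakDeriv_zero_one_iff.2
    ⟨locallyIntegrableOn_zeroExt hf _, locallyIntegrableOn_zeroExt hg _, fun φ hφ => ?_⟩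
  rw [setIntegral_zeroExt_mul, setIntegral_zeroExt_mul]
  exact h φ hφ

/-- `f` has an integrable weak derivative in `y` on the half disc. -/
def HasIntegrableDy (f : ℝ × ℝ → ℝ) : Prop :=
  ∃ g, IntegrableOn f halfDisc ∧ IntegrableOn g halfDisc ∧ IsWeakDeriv halfDisc 0 1 f g

/-- `f` has trace zero on the axis: this is encoded by the extension by zero across the axis
being weakly differentiable in `y`, without a singular part on the axis. -/
def ZeroTrace (f : ℝ × ℝ → ℝ) : Prop :=
  ∃ g, IntegrableOn f halfDisc ∧ IntegrableOn g halfDisc ∧ IsWeakDeriv halfDisc 0 1 f g ∧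
    IsWeakDeriv disc 0 1 (zeroExt f) (zeroExt g)

theorem HasIntegrableDy.add (hf : HasIntegrableDy f) (hg : HasIntegrableDy g) :
    HasIntegrableDy (fun p => f p + g p) := by
  obtain ⟨f', h₁, h₂, h₃⟩ := hf
  obtain ⟨g', h₁', h₂', h₃'⟩ := hg
  exact ⟨_, h₁.add h₁', h₂.add h₂', h₃.add h₃'⟩

theorem HasIntegrableDy.const_mul (hf : HasIntegrableDy f) (c : ℝ) :
    HasIntegrableDy (fun p => c * f p) := by
  obtain ⟨f', h₁, h₂, h₃⟩ := hf
  exact ⟨_, h₁.const_mul c, h₂.const_mul c, h₃.const_mul c⟩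

theorem integrableOn_snd_mul (hf : IntegrableOn f halfDisc) :
    IntegrableOn (fun p => p.2 * f p) halfDisc := by
  refine hf.bdd_mul (c := 1) continuous_snd.aestronglyMeasurable ?_
  filter_upwards [ae_restrict_mem isOpen_halfDisc.measurableSet] with p hp
  exact abs_le.2 (disc_subset_Icc hp.1).2

theorem dx_snd (p : ℝ × ℝ) : dx Prod.snd p = 0 := by
  simp [dx, fderiv_snd]

theorem dy_snd (p : ℝ × ℝ) : dy Prod.snd p = 1 := by
  simp [dy, fderiv_snd]

theorem IsWeakDeriv.snd_mul_dx {Ω : Set (ℝ × ℝ)} (hΩ : IsOpen Ω) (h : IsWeakDeriv Ω 1 0 f g) :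
    IsWeakDeriv Ω 1 0 (fun p => p.2 * f p) (fun p => p.2 * g p) :=
  (h.mul_dx hΩ contDiff_snd.contDiffOn).congr (ae_eq_refl _)
    (ae_of_all _ fun p => by simp only [dx_snd]; ring)

theorem IsWeakDeriv.snd_mul_dy {Ω : Set (ℝ × ℝ)} (hΩ : IsOpen Ω) (h : IsWeakDeriv Ω 0 1 f g) :
    IsWeakDeriv Ω 0 1 (fun p => p.2 * f p) (fun p => f p + p.2 * g p) :=
  (h.mul_dy hΩ contDiff_snd.contDiffOn).congr (ae_eq_refl _)
    (ae_of_all _ fun p => by simp only [dy_snd]; ring)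

theorem HasIntegrableDy.snd_mul (hf : HasIntegrableDy f) :
    HasIntegrableDy (fun p => p.2 * f p) := by
  obtain ⟨g, h₁, h₂, h₃⟩ := hf
  exact ⟨_, integrableOn_snd_mul h₁, h₁.add (integrableOn_snd_mul h₂),
    h₃.snd_mul_dy isOpen_halfDisc⟩

theorem ZeroTrace.add (hf : ZeroTrace f) (hg : ZeroTrace g) :
    ZeroTrace (fun p => f p + g p) := by
  obtain ⟨f', h₁, h₂, h₃, h₄⟩ := hf
  obtain ⟨g', h₁', h₂', h₃', h₄'⟩ := hg
  refine ⟨_, h₁.add h₁', h₂.add h₂', h₃.add h₃', ?_⟩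
  have := h₄.add h₄'
  rwa [← zeroExt_add, ← zeroExt_add] at this

theorem ZeroTrace.const_mul (hf : ZeroTrace f) (c : ℝ) : ZeroTrace (fun p => c * f p) := by
  obtain ⟨f', h₁, h₂, h₃, h₄⟩ := hf
  refine ⟨_, h₁.const_mul c, h₂.const_mul c, h₃.const_mul c, ?_⟩
  have := h₄.const_mul c
  rwa [← zeroExt_const_mul, ← zeroExt_const_mul] at this

theorem IsWeakDeriv.zeroTrace_of_hasBoundaryValue (h : IsWeakDeriv halfDisc 0 1 f g)
    (hf : IntegrableOn f halfDisc) (hg : IntegrableOn g halfDisc)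
    (hbd : ∀ x ∈ Ioo (-1 : ℝ) 1, HasBoundaryValue halfDisc f (x, 0) 0) : ZeroTrace f :=
  ⟨g, hf, hg, h, isWeakDeriv_zeroExt_dy hf hg fun _ hφ =>
    h.integral_mul_dy_of_hasBoundaryValue hf hg hφ hbd⟩

/-- A multiple of `y` has trace zero: the factor can be moved to the test function. -/
theorem HasIntegrableDy.zeroTrace_snd_mul (hf : HasIntegrableDy f) :
    ZeroTrace (fun p => p.2 * f p) := by
  obtain ⟨g, h₁, h₂, h₃⟩ := hf
  have i₁ := integrableOn_snd_mul h₁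
  have i₂ : IntegrableOn (fun p => f p + p.2 * g p) halfDisc := h₁.add (integrableOn_snd_mul h₂)
  refine ⟨_, i₁, i₂, h₃.snd_mul_dy isOpen_halfDisc,
    isWeakDeriv_zeroExt_dy i₁ i₂ fun φ hφ => ?_⟩
  have hχ : IsTestFunction disc (fun p => p.2 * φ p) :=
    ⟨contDiff_snd.mul hφ.1, hφ.2.1.mul_left, tsupport_mul_subset_right.trans hφ.2.2⟩
  have e := h₃.integral_mul_dy_of_eq_zero h₁ h₂ hχ (fun x => by simp)
  have hd : ∀ p : ℝ × ℝ, dy (fun p => p.2 * φ p) p = φ p + p.2 * dy φ p := fun p => by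
    have d₂ : DifferentiableAt ℝ φ p := (hφ.1.differentiable (by simp)).differentiableAt
    simp only [dy, fderiv_fun_mul differentiableAt_snd d₂, add_apply, smul_apply, smul_eq_mul,
      fderiv_snd, ContinuousLinearMap.coe_snd']
    ring
  simp_rw [hd, mul_add] at e
  have j₁ := IntegrableOn.mul_continuous_compactSupport h₁ hφ.1.continuous hφ.2.1
  have j₂ := IntegrableOn.mul_continuous_compactSupport i₁ hφ.dy.1.continuous hφ.dy.2.1
  have j₃ := IntegrableOn.mul_continuous_compactSupport (integrableOn_snd_mul h₂)
    hφ.1.continuous hφ.2.1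
  have e₁ : ∀ p : ℝ × ℝ, f p * (p.2 * dy φ p) = (p.2 * f p) * dy φ p := fun p => by ring
  have e₂ : ∀ p : ℝ × ℝ, g p * (p.2 * φ p) = (p.2 * g p) * φ p := fun p => by ring
  simp_rw [e₁, e₂] at e
  rw [integral_add j₁ j₂] at e
  simp_rw [add_mul]
  rw [integral_add j₁ j₃]
  linarith

/-- Vanishing of the trace is inherited by derivatives along the axis. -/
theorem ZeroTrace.dx (hf : ZeroTrace f) (hx : IsWeakDeriv halfDisc 1 0 f g)
    (hy : IsWeakDeriv halfDisc 0 1 g h) (hg : IntegrableOn g halfDisc)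
    (hh : IntegrableOn h halfDisc) : ZeroTrace g := by
  obtain ⟨k, h₁, h₂, h₃, h₄⟩ := hf
  have hk : IsWeakDeriv halfDisc 1 0 k h := h₃.of_trans (hx.trans hy)
  have hxy : IsWeakDeriv disc 1 1 (zeroExt f) (zeroExt h) := h₄.trans (hk.zeroExt_dx h₂ hh)
  exact ⟨h, hg, hh, hy, (hx.zeroExt_dx h₁ hg).of_trans hxy⟩

end ZeroTrace

/-! ### Gluing along the axis -/

/-- The reflection in the axis. -/
def reflection : ℝ × ℝ ≃ₜ ℝ × ℝ := (Homeomorph.refl ℝ).prodCongr (Homeomorph.neg ℝ)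

theorem reflection_apply (p : ℝ × ℝ) : reflection p = (p.1, -p.2) := rfl

theorem reflection_reflection (p : ℝ × ℝ) : reflection (reflection p) = p := by
  simp [reflection_apply]

theorem measurePreserving_reflection : MeasurePreserving reflection volume volume :=
  (MeasurePreserving.id (volume : Measure ℝ)).prod (Measure.measurePreserving_neg volume)

theorem reflection_mem_disc {p : ℝ × ℝ} : reflection p ∈ disc ↔ p ∈ disc := by
  simp [reflection_apply, disc]

theorem contDiff_reflection : ContDiff ℝ ∞ reflection :=
  contDiff_fst.prodMk contDiff_snd.neg

theorem fderiv_comp_reflection {φ : ℝ × ℝ → ℝ} (hφ : ContDiff ℝ ∞ φ) (p v : ℝ × ℝ) :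
    fderiv ℝ (fun p => φ (reflection p)) p v = fderiv ℝ φ (reflection p) (v.1, -v.2) := by
  have h₁ : HasFDerivAt φ (fderiv ℝ φ (reflection p)) (reflection p) :=
    (hφ.differentiable (by simp)).differentiableAt.hasFDerivAt
  have h₂ : HasFDerivAt reflection
      ((ContinuousLinearMap.fst ℝ ℝ ℝ).prod (-ContinuousLinearMap.snd ℝ ℝ ℝ)) p :=
    hasFDerivAt_fst.prodMk hasFDerivAt_snd.neg
  have h₃ := h₁.comp p h₂
  change fderiv ℝ (φ ∘ reflection) p v = _
  rw [h₃.fderiv]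
  rfl

theorem IsTestFunction.comp_reflection {φ : ℝ × ℝ → ℝ} (hφ : IsTestFunction disc φ) :
    IsTestFunction disc (fun p => φ (reflection p)) := by
  refine ⟨hφ.1.comp contDiff_reflection, hφ.2.1.comp_homeomorph reflection, ?_⟩
  have : tsupport (fun p => φ (reflection p)) = reflection ⁻¹' tsupport φ :=
    tsupport_comp_eq_preimage φ reflection
  rw [this]
  exact fun p hp => reflection_mem_disc.1 (hφ.2.2 hp)

theorem IsTestFunction.sub {Ω : Set (ℝ × ℝ)} {φ ψ : ℝ × ℝ → ℝ} (hφ : IsTestFunction Ω φ)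
    (hψ : IsTestFunction Ω ψ) : IsTestFunction Ω (fun p => φ p - ψ p) :=
  ⟨hφ.1.sub hψ.1, hφ.2.1.sub hψ.2.1, (tsupport_sub φ ψ).trans (union_subset hφ.2.2 hψ.2.2)⟩

/-- The function on the disc which is `g` above the axis and the reflection of `h` below it;
both are given on the upper half disc. -/
def glue (g h : ℝ × ℝ → ℝ) : ℝ × ℝ → ℝ := fun p => if 0 < p.2 then g p else h (reflection p)

section Glue

variable {g h gx hx gy hy φ : ℝ × ℝ → ℝ}

theorem ae_snd_ne_zero : ∀ᵐ p : ℝ × ℝ, p.2 ≠ 0 := by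
  have : (volume : Measure (ℝ × ℝ)) (univ ×ˢ {(0 : ℝ)}) = 0 := by
    rw [Measure.volume_eq_prod, Measure.prod_prod, Real.volume_singleton, mul_zero]
  rw [ae_iff]
  refine measure_mono_null (fun p hp => ?_) this
  exact ⟨mem_univ _, by simpa using hp⟩

theorem ae_mem_halfDisc_or : ∀ᵐ p ∂(volume.restrict disc),
    (p ∈ halfDisc ∧ reflection p ∉ halfDisc) ∨ (¬ 0 < p.2 ∧ p ∉ halfDisc ∧
      reflection p ∈ halfDisc) := by
  filter_upwards [ae_restrict_mem isOpen_disc.measurableSet,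
    ae_restrict_of_ae ae_snd_ne_zero] with p hp hp0
  rcases lt_or_gt_of_ne hp0 with hlt | hgt
  · exact Or.inr ⟨hlt.not_gt, fun h => hlt.not_gt h.2,
      reflection_mem_disc.2 hp, by simpa [reflection_apply] using hlt⟩
  · exact Or.inl ⟨⟨hp, hgt⟩, fun h => by
      have h2 : 0 < (reflection p).2 := h.2
      simp only [reflection_apply] at h2
      linarith⟩

theorem glue_ae_eq (g h : ℝ × ℝ → ℝ) : glue g h =ᵐ[volume.restrict disc]
    fun p => zeroExt g p + zeroExt h (reflection p) := by
  filter_upwards [ae_mem_halfDisc_or] with p hp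
  rcases hp with ⟨h₁, h₂⟩ | ⟨h₀, h₁, h₂⟩
  · simp [glue, zeroExt, h₁, h₂, h₁.2]
  · simp [glue, zeroExt, h₁, h₂, h₀]

theorem glue_congr (hg : g =ᵐ[volume.restrict halfDisc] gx)
    (hh : h =ᵐ[volume.restrict halfDisc] hx) :
    glue g h =ᵐ[volume.restrict disc] glue gx hx := by
  have e : ∀ {a b : ℝ × ℝ → ℝ}, a =ᵐ[volume.restrict halfDisc] b → zeroExt a =ᵐ[volume] zeroExt b :=
    fun hab => by
      filter_upwards [(ae_restrict_iff' isOpen_halfDisc.measurableSet).1 hab] with p hp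
      by_cases hpH : p ∈ halfDisc
      · simp [zeroExt, hpH, hp hpH]
      · simp [zeroExt, hpH]
  refine (glue_ae_eq g h).trans (Filter.EventuallyEq.trans ?_ (glue_ae_eq gx hx).symm)
  filter_upwards [ae_restrict_of_ae (e hg), ae_restrict_of_ae
    (measurePreserving_reflection.quasiMeasurePreserving.ae (e hh))] with p h₁ h₂
  rw [h₁, h₂]

theorem memLp_glue (hg : MemLp g 2 (volume.restrict halfDisc))
    (hh : MemLp h 2 (volume.restrict halfDisc)) :
    MemLp (glue g h) 2 (volume.restrict disc) := by
  have e : ∀ {a : ℝ × ℝ → ℝ}, MemLp a 2 (volume.restrict halfDisc) → MemLp (zeroExt a) 2 volume :=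
    fun ha => (memLp_indicator_iff_restrict isOpen_halfDisc.measurableSet).2 ha
  have h₁ : MemLp (fun p => zeroExt g p + zeroExt h (reflection p)) 2 volume :=
    (e hg).add ((e hh).comp_measurePreserving measurePreserving_reflection)
  exact (h₁.restrict disc).ae_eq (glue_ae_eq g h).symm

theorem locallyIntegrableOn_glue (hg : IntegrableOn g halfDisc) (hh : IntegrableOn h halfDisc) :
    LocallyIntegrableOn (glue g h) disc := by
  have h₁ : Integrable (fun p => zeroExt g p + zeroExt h (reflection p)) :=
    (integrable_zeroExt hg).add
      (measurePreserving_reflection.integrable_comp_of_integrable (integrable_zeroExt hh))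
  have h₂ : IntegrableOn (glue g h) disc := h₁.integrableOn.congr (glue_ae_eq g h).symm
  exact h₂.locallyIntegrableOn

theorem setIntegral_glue_mul (hg : IntegrableOn g halfDisc) (hh : IntegrableOn h halfDisc)
    (hφ : Continuous φ) (hc : HasCompactSupport φ) :
    ∫ p in disc, glue g h p * φ p
      = (∫ p in halfDisc, g p * φ p) + ∫ p in halfDisc, h p * φ (reflection p) := by
  have i₁ := IntegrableOn.mul_continuous_compactSupport (s := disc)
    (integrable_zeroExt hg).integrableOn hφ hc
  have i₂ := IntegrableOn.mul_continuous_compactSupport (s := disc)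
    (measurePreserving_reflection.integrable_comp_of_integrable
      (integrable_zeroExt hh)).integrableOn hφ hc
  have e : (fun p => glue g h p * φ p) =ᵐ[volume.restrict disc]
      fun p => zeroExt g p * φ p + zeroExt h (reflection p) * φ p :=
    (glue_ae_eq g h).mono fun p hp => by simp only [hp, add_mul]
  rw [integral_congr_ae e]
  refine (integral_add i₁ i₂).trans ?_
  have hd : reflection ⁻¹' disc = disc := by ext p; exact reflection_mem_disc
  have er := measurePreserving_reflection.setIntegral_preimage_emb
    reflection.measurableEmbedding (fun p => zeroExt h p * φ (reflection p)) disc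
  simp only [hd, reflection_reflection] at er
  simp only [Function.comp_apply]
  rw [setIntegral_zeroExt_mul, er, setIntegral_zeroExt_mul h]

theorem IsWeakDeriv.glue_dx (hg : IsWeakDeriv halfDisc 1 0 g gx)
    (hh : IsWeakDeriv halfDisc 1 0 h hx) (ig : IntegrableOn g halfDisc)
    (ih : IntegrableOn h halfDisc) (igx : IntegrableOn gx halfDisc)
    (ihx : IntegrableOn hx halfDisc) : IsWeakDeriv disc 1 0 (glue g h) (glue gx hx) := by
  refine isWeakDeriv_one_zero_iff.2 ⟨locallyIntegrableOn_glue ig ih,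
    locallyIntegrableOn_glue igx ihx, fun φ hφ => ?_⟩
  have e := hh.integral_mul_dx ih ihx hφ.comp_reflection
  have hd : ∀ p, dx (fun p => φ (reflection p)) p = dx φ (reflection p) := fun p => by
    rw [dx, fderiv_comp_reflection hφ.1]; simp [dx]
  simp_rw [hd] at e
  change ∫ p in disc, glue g h p * dx φ p = _
  rw [setIntegral_glue_mul ig ih hφ.dx.1.continuous hφ.dx.2.1,
    setIntegral_glue_mul igx ihx hφ.1.continuous hφ.2.1, hg.integral_mul_dx ig igx hφ, e]
  ring

/-- If the traces of `g` and `h` agree, then gluing creates no singular part on the axis.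
The reflection changes the sign of the derivative in `y`. -/
theorem IsWeakDeriv.glue_dy (hg : IsWeakDeriv halfDisc 0 1 g gy)
    (hh : IsWeakDeriv halfDisc 0 1 h hy) (ig : IntegrableOn g halfDisc)
    (ih : IntegrableOn h halfDisc) (igy : IntegrableOn gy halfDisc)
    (ihy : IntegrableOn hy halfDisc) (hz : ZeroTrace (fun p => g p + -1 * h p)) :
    IsWeakDeriv disc 0 1 (glue g h) (glue gy (fun p => -1 * hy p)) := by
  refine isWeakDeriv_zero_one_iff.2 ⟨locallyIntegrableOn_glue ig ih,
    locallyIntegrableOn_glue igy (ihy.const_mul _), fun φ hφ => ?_⟩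
  change ∫ p in disc, glue g h p * dy φ p = _
  rw [setIntegral_glue_mul ig ih hφ.dy.1.continuous hφ.dy.2.1,
    setIntegral_glue_mul igy (ihy.const_mul _) hφ.1.continuous hφ.2.1]
  have hR := hφ.comp_reflection
  have hdR : ∀ p, dy (fun p => φ (reflection p)) p = -dy φ (reflection p) := fun p => by
    rw [dy, fderiv_comp_reflection hφ.1, dy, ← map_neg]; simp
  -- The odd part of the test function vanishes on the axis, and pairs with `h`;
  -- the test function itself pairs with `g - h`.
  have e₁ := hh.integral_mul_dy_of_eq_zero ih ihy (hφ.sub hR)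
    (fun x => by simp [reflection_apply])
  have hd : ∀ p, dy (fun p => φ p - φ (reflection p)) p = dy φ p + dy φ (reflection p) :=
    fun p => by
      have d₁ : DifferentiableAt ℝ φ p := (hφ.1.differentiable (by simp)).differentiableAt
      have d₂ : DifferentiableAt ℝ (fun p => φ (reflection p)) p :=
        (hR.1.differentiable (by simp)).differentiableAt
      have := hdR p
      simp only [dy] at this ⊢
      rw [fderiv_fun_sub d₁ d₂, sub_apply, this, sub_neg_eq_add]
  obtain ⟨k, -, ik, hk, hk'⟩ := hz
  have hae := hk.unique isOpen_halfDisc (hg.add (hh.const_mul (-1)))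
  have e₂ := (isWeakDeriv_zero_one_iff.1 hk').2.2 φ hφ
  change ∫ p in disc, zeroExt (fun p => g p + -1 * h p) p * dy φ p = _ at e₂
  have hae' : (fun p => k p * φ p) =ᵐ[volume.restrict halfDisc]
      fun p => (gy p + -1 * hy p) * φ p := hae.mono fun p hp => by simp only [hp]
  rw [setIntegral_zeroExt_mul, setIntegral_zeroExt_mul, integral_congr_ae hae'] at e₂
  have c : ∀ {a χ : ℝ × ℝ → ℝ}, IntegrableOn a halfDisc → IsTestFunction disc χ →
      IntegrableOn (fun p => a p * χ p) halfDisc := fun ha hχ =>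
    IntegrableOn.mul_continuous_compactSupport ha hχ.1.continuous hχ.2.1
  simp_rw [hd, mul_add, mul_sub] at e₁
  rw [integral_add (c ih hφ.dy) (c ih hφ.dy.comp_reflection),
    integral_sub (c ihy hφ) (c ihy hR)] at e₁
  simp_rw [add_mul, mul_assoc] at e₂ ⊢
  rw [integral_add (c ig hφ.dy) ((c ih hφ.dy).const_mul _),
    integral_add (c igy hφ) ((c ihy hφ).const_mul _), integral_const_mul,
    integral_const_mul] at e₂
  rw [integral_const_mul]
  linarith

end Glue

/-! ### The extended solution and its derivatives -/

section Sums

variable {Ω : Set (ℝ × ℝ)} {k : ℕ}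

theorem memH_zero_fun : MemH k Ω (fun _ => 0) := by
  refine ⟨MemLp.zero', fun i j _ => ⟨fun _ => 0, MemLp.zero', locallyIntegrableOn_zero,
    locallyIntegrableOn_zero, fun φ _ => by simp⟩⟩

theorem MemH.sum {ι : Type*} {s : Finset ι} {f : ι → ℝ × ℝ → ℝ} (h : ∀ i ∈ s, MemH k Ω (f i)) :
    MemH k Ω (fun p => ∑ i ∈ s, f i p) := by
  classical
  induction s using Finset.induction_on with
  | empty => simpa using memH_zero_fun
  | insert i s hi ih =>
    simp_rw [Finset.sum_insert hi]
    exact (h i (Finset.mem_insert_self i s)).add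
      (ih fun j hj => h j (Finset.mem_insert_of_mem hj))

end Sums

theorem weakLap_ae_eq {Ω : Set (ℝ × ℝ)} (hΩ : IsOpen Ω) {f f' g₁ g₂ : ℝ × ℝ → ℝ}
    (hf : f' =ᵐ[volume.restrict Ω] f) (h₁ : IsWeakDeriv Ω 2 0 f' g₁)
    (h₂ : IsWeakDeriv Ω 0 2 f' g₂) :
    weakLap Ω f =ᵐ[volume.restrict Ω] fun p => g₁ p + g₂ p :=
  ((h₁.congr hf (ae_eq_refl _)).weakD_ae_eq hΩ).add
    ((h₂.congr hf (ae_eq_refl _)).weakD_ae_eq hΩ)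

theorem weakLap_weakLap_ae_eq {Ω : Set (ℝ × ℝ)} (hΩ : IsOpen Ω) {f : ℝ × ℝ → ℝ}
    {V : ℕ → ℕ → ℝ × ℝ → ℝ} (h : ∀ i j, i + j ≤ 4 → IsWeakDeriv Ω i j f (V i j)) :
    weakLap Ω (weakLap Ω f) =ᵐ[volume.restrict Ω]
      fun p => V 4 0 p + 2 * V 2 2 p + V 0 4 p := by
  have e₁ := weakLap_ae_eq hΩ (ae_eq_refl f) (h 2 0 (by norm_num)) (h 0 2 (by norm_num))
  have d₁ : IsWeakDeriv Ω 2 0 (V 2 0) (V 4 0) := (h 2 0 (by norm_num)).of_trans (h 4 0 le_rfl)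
  have d₂ : IsWeakDeriv Ω 2 0 (V 0 2) (V 2 2) := (h 0 2 (by norm_num)).of_trans (h 2 2 le_rfl)
  have d₃ : IsWeakDeriv Ω 0 2 (V 2 0) (V 2 2) := (h 2 0 (by norm_num)).of_trans (h 2 2 le_rfl)
  have d₄ : IsWeakDeriv Ω 0 2 (V 0 2) (V 0 4) := (h 0 2 (by norm_num)).of_trans (h 0 4 le_rfl)
  refine (weakLap_ae_eq hΩ e₁.symm (d₁.add d₂) (d₃.add d₄)).trans (ae_of_all _ fun p => ?_)
  ring

/-- `V i j`, for `i + j ≤ N`, are square integrable functions on the half disc, each of which is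
the weak derivative of order `(i, j)` of `V 0 0`. -/
structure IsDerivFamily (N : ℕ) (V : ℕ → ℕ → ℝ × ℝ → ℝ) : Prop where
  memLp : ∀ {i j : ℕ}, i + j ≤ N → MemLp (V i j) 2 (volume.restrict halfDisc)
  dx : ∀ {i j : ℕ}, i + j < N → IsWeakDeriv halfDisc 1 0 (V i j) (V (i + 1) j)
  dy : ∀ {i j : ℕ}, i + j < N → IsWeakDeriv halfDisc 0 1 (V i j) (V i (j + 1))

theorem isDerivFamily_weakD {k : ℕ} {u : ℝ × ℝ → ℝ} (hu : MemH k halfDisc u) :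
    IsDerivFamily k (fun i j => weakD halfDisc i j u) where
  memLp h := (hu.weakD isOpen_halfDisc (l := 0) h).1
  dx h := (hu.isWeakDeriv_weakD h.le).of_trans (hu.isWeakDeriv_weakD (by omega))
  dy h := (hu.isWeakDeriv_weakD h.le).of_trans (hu.isWeakDeriv_weakD (by omega))

theorem memLp_snd_mul {f : ℝ × ℝ → ℝ} (hf : MemLp f 2 (volume.restrict halfDisc)) :
    MemLp (fun p => p.2 * f p) 2 (volume.restrict halfDisc) :=
  memLp_continuousOn_mul isOpen_halfDisc isCompact_closure_halfDisc continuousOn_snd hf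

/-- The derivatives of the Laplacian, in terms of the derivatives `V` of a function. -/
def lapFamily (V : ℕ → ℕ → ℝ × ℝ → ℝ) (i j : ℕ) : ℝ × ℝ → ℝ :=
  fun p => V (i + 2) j p + V i (j + 2) p

/-- The derivative of order `(i, j)` of `-(v - 2 y v_y + y² Δv)`, in terms of the derivatives
`V` of `v`. This is the function whose reflection extends `v` to the lower half disc. For `j < 2`
the terms with a truncated index `j - 1` or `j - 2` have coefficient `0`. -/
def lowerFamily (V : ℕ → ℕ → ℝ × ℝ → ℝ) (i j : ℕ) : ℝ × ℝ → ℝ :=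
  fun p => (2 * j - 1) * V i j p + (2 * (p.2 * V i (j + 1) p) +
    (-1 * (p.2 * (p.2 * lapFamily V i j p)) + (-(2 * j) * (p.2 * lapFamily V i (j - 1) p) +
      -(j * (j - 1)) * lapFamily V i (j - 2) p)))

section Families

variable {N : ℕ} {V : ℕ → ℕ → ℝ × ℝ → ℝ}

theorem IsDerivFamily.integrableOn (hV : IsDerivFamily N V) {i j : ℕ} (h : i + j ≤ N) :
    IntegrableOn (V i j) halfDisc :=
  integrableOn_halfDisc_of_memLp (hV.memLp h)

theorem IsDerivFamily.isWeakDeriv (hV : IsDerivFamily N V) {i j : ℕ} (h : i + j ≤ N) :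
    IsWeakDeriv halfDisc i j (V 0 0) (V i j) := by
  induction j with
  | zero =>
    induction i with
    | zero => exact isWeakDeriv_self (locallyIntegrableOn_of_memLp (hV.memLp (by omega)))
    | succ i ih => exact (ih (by omega)).trans (hV.dx (by omega))
  | succ j ih => exact (ih (by omega)).trans (hV.dy (by omega))

theorem IsDerivFamily.hasIntegrableDy (hV : IsDerivFamily N V) {i j : ℕ} (h : i + j < N) :
    HasIntegrableDy (V i j) :=
  ⟨_, hV.integrableOn h.le, hV.integrableOn (by omega), hV.dy h⟩

theorem IsDerivFamily.lap (hV : IsDerivFamily (N + 2) V) :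
    IsDerivFamily N (lapFamily V) where
  memLp h := (hV.memLp (by omega)).add (hV.memLp (by omega))
  dx {i j} h := by
    have h₁ := hV.dx (i := i + 2) (j := j) (by omega)
    have h₂ := hV.dx (i := i) (j := j + 2) (by omega)
    exact h₁.add h₂
  dy {i j} h := by
    have h₁ := hV.dy (i := i + 2) (j := j) (by omega)
    have h₂ := hV.dy (i := i) (j := j + 2) (by omega)
    exact h₁.add h₂

theorem IsDerivFamily.lower (hV : IsDerivFamily (N + 2) V) :
    IsDerivFamily N (lowerFamily V) where
  memLp {i j} h := by
    have hL := hV.lap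
    exact ((hV.memLp (by omega)).const_mul _).add (((memLp_snd_mul (hV.memLp
      (by omega))).const_mul _).add (((memLp_snd_mul (memLp_snd_mul (hL.memLp
      (by omega)))).const_mul _).add (((memLp_snd_mul (hL.memLp (by omega))).const_mul _).add
      ((hL.memLp (by omega)).const_mul _))))
  dx {i j} h := by
    have hL := hV.lap
    have hH := isOpen_halfDisc
    exact ((hV.dx (by omega)).const_mul _).add ((((hV.dx (by omega)).snd_mul_dx
      hH).const_mul _).add (((((hL.dx (by omega)).snd_mul_dx hH).snd_mul_dx hH).const_mul _).add
      ((((hL.dx (by omega)).snd_mul_dx hH).const_mul _).add ((hL.dx (by omega)).const_mul _))))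
  dy {i j} h := by
    have hL := hV.lap
    have hH := isOpen_halfDisc
    have key := ((hV.dy (i := i) (j := j) (by omega)).const_mul (2 * j - 1)).add
      ((((hV.dy (i := i) (j := j + 1) (by omega)).snd_mul_dy hH).const_mul 2).add
      (((((hL.dy (i := i) (j := j) (by omega)).snd_mul_dy hH).snd_mul_dy hH).const_mul (-1)).add
      ((((hL.dy (i := i) (j := j - 1) (by omega)).snd_mul_dy hH).const_mul (-(2 * j))).add
      ((hL.dy (i := i) (j := j - 2) (by omega)).const_mul (-(j * (j - 1)))))))
    refine key.congr (ae_eq_refl _) (ae_of_all _ fun p => ?_)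
    match j with
    | 0 =>
      simp only [lowerFamily, Nat.zero_sub, Nat.add_sub_cancel]
      push_cast
      ring
    | 1 =>
      simp only [lowerFamily, Nat.sub_self, Nat.add_sub_cancel]
      push_cast
      ring
    | j + 2 =>
      simp only [lowerFamily, show j + 2 + 1 - 1 = j + 2 by omega,
        show j + 2 + 1 - 2 = j + 1 by omega, show j + 2 - 1 = j + 1 by omega,
        show j + 2 - 2 = j by omega, show j + 1 + 1 = j + 2 by omega]
      push_cast
      ring

theorem IsDerivFamily.zeroTrace_dx (hV : IsDerivFamily N V) {i j : ℕ}
    (h0 : ZeroTrace (V 0 j)) (h : i + j < N) : ZeroTrace (V i j) := by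
  induction i with
  | zero => exact h0
  | succ i ih =>
    exact (ih (by omega)).dx (hV.dx (by omega)) (hV.dy h) (hV.integrableOn h.le)
      (hV.integrableOn (by omega))

/-- The traces on the axis of the derivatives up to order three of the two parts match. Up to
multiples of `y`, the jump is a derivative along the axis of `v` or of `v_y`. -/
theorem IsDerivFamily.zeroTrace_jump (hV : IsDerivFamily 6 V) (h0 : ZeroTrace (V 0 0))
    (h1 : ZeroTrace (V 0 1)) {i j : ℕ} (hij : i + j < 4) :
    ZeroTrace (fun p => V i j p + -1 * ((-1) ^ j * lowerFamily V i j p)) := by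
  have hL := hV.lap
  have hj : j < 4 := by omega
  interval_cases j
  · have := ((hV.zeroTrace_dx h0 (i := i) (by omega)).const_mul 2).add
      (((hV.hasIntegrableDy (i := i) (j := 1) (by omega)).const_mul (-2)).add
        (hL.hasIntegrableDy (i := i) (j := 0) (by omega)).snd_mul).zeroTrace_snd_mul
    convert this using 2 with p
    simp only [lowerFamily]; push_cast; ring
  · have := ((hV.zeroTrace_dx h1 (i := i) (by omega)).const_mul 2).add
      (((hV.hasIntegrableDy (i := i) (j := 2) (by omega)).const_mul 2).add
        (((hL.hasIntegrableDy (i := i) (j := 1) (by omega)).snd_mul.const_mul (-1)).add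
        ((hL.hasIntegrableDy (i := i) (j := 0) (by omega)).const_mul (-2)))).zeroTrace_snd_mul
    convert this using 2 with p
    simp only [lowerFamily]; push_cast; ring
  · have := ((hV.zeroTrace_dx h0 (i := i + 2) (by omega)).const_mul 2).add
      (((hV.hasIntegrableDy (i := i) (j := 3) (by omega)).const_mul (-2)).add
        ((hL.hasIntegrableDy (i := i) (j := 2) (by omega)).snd_mul.add
        ((hL.hasIntegrableDy (i := i) (j := 1) (by omega)).const_mul 4))).zeroTrace_snd_mul
    convert this using 2 with p
    simp only [lowerFamily, lapFamily]; push_cast; ring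
  · have := ((hV.zeroTrace_dx h1 (i := i + 2) (by omega)).const_mul (-6)).add
      (((hV.hasIntegrableDy (i := i) (j := 4) (by omega)).const_mul 2).add
        (((hL.hasIntegrableDy (i := i) (j := 3) (by omega)).snd_mul.const_mul (-1)).add
        ((hL.hasIntegrableDy (i := i) (j := 2) (by omega)).const_mul (-6)))).zeroTrace_snd_mul
    convert this using 2 with p
    simp only [lowerFamily, lapFamily]; push_cast; ring

/-- The derivative of order `(i, j)` of the extension to the disc of a function with
derivatives `V`. -/
def extFamily (V : ℕ → ℕ → ℝ × ℝ → ℝ) (i j : ℕ) : ℝ × ℝ → ℝ :=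
  glue (V i j) (fun p => (-1) ^ j * lowerFamily V i j p)

theorem IsDerivFamily.memLp_extFamily (hV : IsDerivFamily 6 V) {i j : ℕ} (h : i + j ≤ 4) :
    MemLp (extFamily V i j) 2 (volume.restrict disc) :=
  memLp_glue (hV.memLp (by omega)) ((hV.lower.memLp h).const_mul _)

theorem IsDerivFamily.isWeakDeriv_extFamily (hV : IsDerivFamily 6 V) (h0 : ZeroTrace (V 0 0))
    (h1 : ZeroTrace (V 0 1)) {i j : ℕ} (h : i + j ≤ 4) :
    IsWeakDeriv disc i j (extFamily V 0 0) (extFamily V i j) := by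
  have hW := hV.lower
  have hi : ∀ {i j : ℕ}, i + j ≤ 4 →
      IntegrableOn (fun p => (-1) ^ j * lowerFamily V i j p) halfDisc :=
    fun h => (hW.integrableOn h).const_mul _
  induction j with
  | zero =>
    induction i with
    | zero => exact isWeakDeriv_self (locallyIntegrableOn_of_memLp (hV.memLp_extFamily h))
    | succ i ih =>
      exact (ih (by omega)).trans ((hV.dx (by omega)).glue_dx ((hW.dx (by omega)).const_mul _)
        (hV.integrableOn (by omega)) (hi (by omega)) (hV.integrableOn (by omega)) (hi h))
  | succ j ih =>
    have key := (hV.dy (i := i) (j := j) (by omega)).glue_dy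
      ((hW.dy (i := i) (j := j) (by omega)).const_mul ((-1) ^ j))
      (hV.integrableOn (by omega)) (hi (by omega)) (hV.integrableOn (by omega))
      ((hW.integrableOn h).const_mul _) (hV.zeroTrace_jump h0 h1 (i := i) (j := j) (by omega))
    refine (ih (by omega)).trans (key.congr (ae_eq_refl _) (ae_of_all _ fun p => ?_))
    simp only [extFamily, glue, pow_succ]
    split_ifs
    · rfl
    · ring

/-- The bilaplacian of `-(v - 2 y v_y + y² Δv)` is `-(5 B + 6 y B_y + y² ΔB)` with `B = Δ²v`. -/
theorem lowerFamily_bilaplacian (p : ℝ × ℝ) :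
    lowerFamily V 4 0 p + 2 * lowerFamily V 2 2 p + lowerFamily V 0 4 p =
      -(5 * (lapFamily (lapFamily V) 0 0 p) + 6 * p.2 * lapFamily (lapFamily V) 0 1 p +
        p.2 ^ 2 * lapFamily (lapFamily (lapFamily V)) 0 0 p) := by
  simp only [lowerFamily, lapFamily]
  push_cast
  ring

end Families

theorem extended_eq_glue (u : ℝ × ℝ → ℝ) : extended u = glue u (fun p =>
    -(u p - 2 * p.2 * weakD halfDisc 0 1 u p + p.2 ^ 2 * weakLap halfDisc u p)) := by
  funext p
  simp only [extended, glue, reflected, reflection_apply]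
  split_ifs
  · rfl
  · ring

theorem extendedRhs_eq_glue (F : ℝ × ℝ → ℝ) : extendedRhs F = glue F (fun p =>
    -(5 * F p + 6 * p.2 * weakD halfDisc 0 1 F p + p.2 ^ 2 * weakLap halfDisc F p)) := by
  funext p
  simp only [extendedRhs, glue, reflectedRhs, reflection_apply]
  split_ifs
  · rfl
  · ring

theorem extended_ae_eq {u : ℝ × ℝ → ℝ} (hu : MemH 0 halfDisc u) :
    extFamily (fun i j => weakD halfDisc i j u) 0 0 =ᵐ[volume.restrict disc] extended u := by
  have e : weakD halfDisc 0 0 u =ᵐ[volume.restrict halfDisc] u :=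
    (isWeakDeriv_self (locallyIntegrableOn_of_memLp hu.1)).weakD_ae_eq isOpen_halfDisc
  rw [extended_eq_glue]
  refine glue_congr e (e.mono fun p hp => ?_)
  simp only [lowerFamily, lapFamily, weakLap, hp]
  push_cast
  ring

theorem extendedRhs_ae_eq {V : ℕ → ℕ → ℝ × ℝ → ℝ} {F : ℝ × ℝ → ℝ} (hV : IsDerivFamily 6 V)
    (hF : F =ᵐ[volume.restrict halfDisc] lapFamily (lapFamily V) 0 0) :
    extendedRhs F =ᵐ[volume.restrict disc]
      fun p => extFamily V 4 0 p + 2 * extFamily V 2 2 p + extFamily V 0 4 p := by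
  have hB : IsDerivFamily 2 (lapFamily (lapFamily V)) := hV.lap.lap
  have e₁ := ((hB.isWeakDeriv (i := 0) (j := 1) (by norm_num)).congr hF.symm
    (ae_eq_refl _)).weakD_ae_eq isOpen_halfDisc
  have e₂ := weakLap_ae_eq isOpen_halfDisc hF.symm (hB.isWeakDeriv (i := 2) (j := 0) le_rfl)
    (hB.isWeakDeriv (i := 0) (j := 2) le_rfl)
  have e₃ : (fun p => -(5 * F p + 6 * p.2 * weakD halfDisc 0 1 F p +
      p.2 ^ 2 * weakLap halfDisc F p)) =ᵐ[volume.restrict halfDisc] fun p =>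
      lowerFamily V 4 0 p + 2 * lowerFamily V 2 2 p + lowerFamily V 0 4 p := by
    filter_upwards [hF, e₁, e₂] with p h₀ h₁ h₂
    rw [lowerFamily_bilaplacian, h₀, h₁, h₂]
    rfl
  rw [extendedRhs_eq_glue]
  refine (glue_congr hF e₃).trans (ae_of_all _ fun p => ?_)
  simp only [glue, extFamily]
  split_ifs
  · simp only [lapFamily]; ring
  · ring

/-- The right-hand side contains derivatives of `u` of order at most three, and its coefficients
are multipliers of `H ^ 2`. -/
theorem memH_rhsF {a : ℝ × ℝ → ℝ × ℝ} {c : ℕ → ℕ → ℝ × ℝ → ℝ} {u : ℝ × ℝ → ℝ}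
    (ha : ContDiffOn ℝ 2 a (closure halfDisc))
    (hc : ∀ i j : ℕ, i + j ≤ 2 → ContDiffOn ℝ 2 (c i j) (closure halfDisc))
    (hu : MemH 5 halfDisc u) : MemH 2 halfDisc (rhsF a c u) := by
  have hH := isOpen_halfDisc
  have hmul : ∀ {b f : ℝ × ℝ → ℝ}, ContDiffOn ℝ 2 b (closure halfDisc) → MemH 2 halfDisc f →
      MemH 2 halfDisc (fun p => b p * f p) := fun hb hf =>
    hf.contDiffOn_mul hH isCompact_closure_halfDisc uniqueDiffOn_closure_halfDisc hb
  have hL : MemH 3 halfDisc (weakLap halfDisc u) := hu.weakLap hH (by norm_num)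
  refine ((hmul ha.fst (hL.weakD hH (by norm_num))).add
    (hmul ha.snd (hL.weakD hH (by norm_num)))).add
    (MemH.sum fun i hi => MemH.sum fun j hj => ?_)
  have hij : i + j ≤ 2 := by
    rw [Finset.mem_range] at hi hj
    omega
  exact hmul (hc i j hij) (hu.weakD hH (by omega))

end PlateReflection

end

open PlateReflection
theorem proposition4p1
    (a : ℝ × ℝ → ℝ × ℝ) (c : ℕ → ℕ → ℝ × ℝ → ℝ) (u : ℝ × ℝ → ℝ)
    (ha : ContDiffOn ℝ 3 a (closure halfDisc))
    (hc : ∀ i j : ℕ, i + j ≤ 2 → ContDiffOn ℝ 2 (c i j) (closure halfDisc))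
    (hu : MemH 6 halfDisc u)
    (heq : ∀ᵐ p ∂(volume.restrict halfDisc),
      weakLap halfDisc (weakLap halfDisc u) p = rhsF a c u p)
    (hbd : ∀ x ∈ Ioo (-1 : ℝ) 1,
      HasBoundaryValue halfDisc u (x, 0) 0 ∧
        HasBoundaryValue halfDisc (weakD halfDisc 0 1 u) (x, 0) 0) :
    MemH 2 halfDisc (rhsF a c u) ∧
      MemH 4 disc (extended u) ∧
      ∀ᵐ p ∂(volume.restrict disc),
        weakLap disc (weakLap disc (extended u)) p = extendedRhs (rhsF a c u) p := by
  set V : ℕ → ℕ → ℝ × ℝ → ℝ := fun i j => weakD halfDisc i j u with hVdef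
  have hV : IsDerivFamily 6 V := isDerivFamily_weakD hu
  have e₀ : u =ᵐ[volume.restrict halfDisc] V 0 0 :=
    ((isWeakDeriv_self (locallyIntegrableOn_of_memLp hu.1)).weakD_ae_eq isOpen_halfDisc).symm
  have hbd₀ : ∀ x ∈ Ioo (-1 : ℝ) 1, HasBoundaryValue halfDisc (V 0 0) (x, 0) 0 := fun x hx =>
    (hbd x hx).1.congr' (e₀.filter_mono inf_le_right)
  have h0 : ZeroTrace (V 0 0) := (hV.dy (by norm_num)).zeroTrace_of_hasBoundaryValue
    (hV.integrableOn (by norm_num)) (hV.integrableOn (by norm_num)) hbd₀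
  have h1 : ZeroTrace (V 0 1) := (hV.dy (by norm_num)).zeroTrace_of_hasBoundaryValue
    (hV.integrableOn (by norm_num)) (hV.integrableOn (by norm_num)) fun x hx => (hbd x hx).2
  have hE : ∀ i j, i + j ≤ 4 → IsWeakDeriv disc i j (extended u) (extFamily V i j) :=
    fun i j hij => (hV.isWeakDeriv_extFamily h0 h1 hij).congr
      (extended_ae_eq (hu.mono (Nat.zero_le _))) (ae_eq_refl _)
  have hF : rhsF a c u =ᵐ[volume.restrict halfDisc] lapFamily (lapFamily V) 0 0 := by
    filter_upwards [heq, weakLap_weakLap_ae_eq isOpen_halfDisc (V := V)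
      fun i j hij => hu.isWeakDeriv_weakD (hij.trans (by norm_num))] with p h₁ h₂
    rw [← h₁, h₂]
    simp only [lapFamily]
    ring
  refine ⟨memH_rhsF (ha.of_le (by norm_num)) hc (hu.mono (by norm_num)), ⟨?_, fun i j hij =>
    ⟨_, hV.memLp_extFamily hij, hE i j hij⟩⟩, ?_⟩
  · exact (hV.memLp_extFamily (by norm_num)).ae_eq (extended_ae_eq (hu.mono (Nat.zero_le _)))
  · exact (weakLap_weakLap_ae_eq isOpen_disc hE).trans (extendedRhs_ae_eq hV hF).symm
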